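/- All graphs are finite, simple and undirected. An instance of GMEG-Set consists of a connected graph $G=(V,E)$ with $n=|V|$, non-negative rational edge weights $w$ (written in binary), vertex costs $c(v)\in\{0,1\}$, and a set $E'\subseteq E$. An edge is monitored by a pair of distinct vertices $x,y$ if it lies on all minimum-weight paths between $x$ and $y$. A solution is a set $M\subseteq V$ such that each edge of $E'$ is monitored by some pair of vertices in $M$; its cost is $c(M)=\sum_{v\in M}c(v)$, to be minimized. Only instances that have a solution are considered. For $\alpha\in(0,\frac12)$, an $\alpha$-balanced vertex-separator of a (not necessarily connected) graph $G=(V,E)$ is a partition of $V$ into three non-empty sets $S,A,B$ such that every path from a vertex of $A$ to a vertex of $B$ contains a vertex of $S$, and $\min\{|A|,|B|\}\ge\alpha|V|$; its size is $|S|$. Let $\alpha\in(0,\frac12)$ and $\beta\ge 0$, and let $\mathcal G$ be a class of graphs that is closed under induced subgraphs and isomorphism, and for which there are constants $n_0\in\mathbb N$ and $\beta_0\ge 1$ and a polynomial-time algorithm that finds, for every graph of $\mathcal G$ with $n\ge n_0$ vertices, an $\alpha$-balanced vertex-separator of size at most $\beta_0 n^\beta$ (in particular such a separator exists). Then there exist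 a constant $K$ and a polynomial-time algorithm that, for every GMEG-Set instance with a solution and with a connected graph $G\in\mathcal G$, outputs a solution $M$ such that, if $c(V)\ge 2$, every solution $M'$ satisfies $$c(M)\le K\,c(V)^{\beta/2}\sqrt{\log n}\;c(M')\quad\text{if }\beta>0,\qquad c(M)\le K\,\log c(V)\,\sqrt{\log n}\;c(M')\quad\text{if }\beta=0,$$ and such that $M$ is a solution of minimum cost if $c(V)\le 1$. That is, GMEG-Set on $\mathcal G$ admits polynomial-time approximation with ratio $O(c(V)^{\beta/2}\sqrt{\log n})$ if $\beta>0$ and $O(\log c(V)\cdot\sqrt{\log n})$ if $\beta=0$. -/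

import Mathlib

namespace GMEG

/-! ### Machine model

Values are binary trees whose leaves are natural numbers. Programs are built from the structural
operations on such trees, arithmetic on leaves, branching and unbounded loops. As on a pointer
machine, values are immutable and shared, so a structural operation costs one step; arithmetic is
charged by the logarithmic cost criterion, that is, by the binary length of its operands. Running
times are therefore polynomially related to those of Turing machines. -/

/-- Data values. Lists are written with `num 0` as the empty list and `pair` as the constructor. -/
inductive Val : Type
  | num (k : ℕ) : Val
  | pair (a b : Val) : Val

namespace Val

/-- The length of a value, with all numbers written in binary. -/
def size : Val → ℕ
  | num k => k.size + 1
  | pair a b => a.size + b.size + 1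

/-- First component of a pair (`0` on a number). -/
def fst : Val → Val
  | num _ => num 0
  | pair a _ => a

/-- Second component of a pair (`0` on a number). -/
def snd : Val → Val
  | num _ => num 0
  | pair _ b => b

/-- The value that represents a list of values. -/
def ofList : List Val → Val
  | [] => num 0
  | a :: l => pair a (ofList l)

end Val

/-- The arithmetic operations: addition, truncated subtraction, multiplication, rounded-down
division. -/
inductive Arith : Type
  | add | sub | mul | div

/-- The action of an arithmetic operation on two numbers. -/
def Arith.onNat : Arith → ℕ → ℕ → ℕ
  | add, a, b => a + b
  | sub, a, b => a - b
  | mul, a, b => a * b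
  | div, a, b => a / b

/-- The action on a value: the operands are the two components of a pair of numbers; the result
is `0` on every other value. -/
def Arith.apply (o : Arith) : Val → Val
  | .pair (.num a) (.num b) => .num (o.onNat a b)
  | _ => .num 0

/-- The logarithmic cost of an arithmetic operation. -/
def Arith.cost : Val → ℕ
  | .pair (.num a) (.num b) => a.size + b.size + 1
  | _ => 1

/-- Programs; each one computes a partial function from values to values. -/
inductive Prog : Type
  /-- the identity -/
  | id : Prog
  /-- a constant number -/
  | const (k : ℕ) : Prog
  /-- first component -/
  | fst : Prog
  /-- second component -/
  | snd : Prog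
  /-- an arithmetic operation -/
  | arith (o : Arith) : Prog
  /-- `x ↦ (f x, g x)` -/
  | pair (f g : Prog) : Prog
  /-- first `f`, then `g` -/
  | seq (f g : Prog) : Prog
  /-- `if c x ≠ 0 then f x else g x` -/
  | ite (c f g : Prog) : Prog
  /-- `while c x ≠ 0 do x := f x` -/
  | loop (c f : Prog) : Prog

/-- `Run P x y t`: on input `x` the program `P` halts with output `y` after exactly `t` steps. -/
inductive Run : Prog → Val → Val → ℕ → Prop
  | id (x : Val) : Run .id x x 1
  | const (k : ℕ) (x : Val) : Run (.const k) x (.num k) (k.size + 1)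
  | fst (x : Val) : Run .fst x x.fst 1
  | snd (x : Val) : Run .snd x x.snd 1
  | arith (o : Arith) (x : Val) : Run (.arith o) x (o.apply x) (Arith.cost x)
  | pair {f g : Prog} {x y z : Val} {s t : ℕ} (hf : Run f x y s) (hg : Run g x z t) :
      Run (.pair f g) x (.pair y z) (s + t + 1)
  | seq {f g : Prog} {x y z : Val} {s t : ℕ} (hf : Run f x y s) (hg : Run g y z t) :
      Run (.seq f g) x z (s + t + 1)
  | iteTrue {c f g : Prog} {x b y : Val} {s t : ℕ} (hc : Run c x b s) (hb : b ≠ .num 0)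
      (hf : Run f x y t) : Run (.ite c f g) x y (s + t + 1)
  | iteFalse {c f g : Prog} {x y : Val} {s t : ℕ} (hc : Run c x (.num 0) s)
      (hg : Run g x y t) : Run (.ite c f g) x y (s + t + 1)
  | loopStop {c f : Prog} {x : Val} {s : ℕ} (hc : Run c x (.num 0) s) :
      Run (.loop c f) x x (s + 1)
  | loopStep {c f : Prog} {x b y z : Val} {r s t : ℕ} (hc : Run c x b r) (hb : b ≠ .num 0)
      (hf : Run f x y s) (hl : Run (.loop c f) y z t) :
      Run (.loop c f) x z (r + s + t + 1)

/-- On input `x`, the program `P` outputs `y` within `p (size of x)` steps. -/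
def OutputsWithin (P : Prog) (p : Polynomial ℕ) (x y : Val) : Prop :=
  ∃ t : ℕ, Run P x y t ∧ t ≤ p.eval x.size

/-! ### Encodings -/

/-- A set of vertices is encoded by its characteristic 0/1 list. -/
def encodeSet {n : ℕ} (M : Finset (Fin n)) : Val :=
  .ofList (List.ofFn fun v : Fin n => .num (if v ∈ M then 1 else 0))

open Classical in
/-- A graph is encoded by its number of vertices and its 0/1 adjacency matrix. -/
noncomputable def encodeGraph {n : ℕ} (G : SimpleGraph (Fin n)) : Val :=
  .pair (.num n) (.ofList (List.ofFn fun u : Fin n =>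
    .ofList (List.ofFn fun v : Fin n => .num (if G.Adj u v then 1 else 0))))

/-! ### Graph classes with balanced separators -/

/-- A class of finite simple graphs (not necessarily connected). -/
abbrev GraphClass : Type := ∀ n : ℕ, SimpleGraph (Fin n) → Prop

/-- Closed under induced subgraphs (hence under isomorphism). -/
def Hereditary (𝒢 : GraphClass) : Prop :=
  ∀ (m n : ℕ) (H : SimpleGraph (Fin m)) (G : SimpleGraph (Fin n)),
    𝒢 n G → Nonempty (H ↪g G) → 𝒢 m H

/-- `S, A, B` is an `α`-balanced vertex-separator of `G`. -/
structure IsBalancedSeparator {V : Type} [Fintype V] [DecidableEq V] (G : SimpleGraph V) (α : ℝ)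
    (S A B : Finset V) : Prop where
  nonempty_S : S.Nonempty
  nonempty_A : A.Nonempty
  nonempty_B : B.Nonempty
  disjoint_SA : Disjoint S A
  disjoint_SB : Disjoint S B
  disjoint_AB : Disjoint A B
  union_eq : S ∪ A ∪ B = Finset.univ
  separates : ∀ a ∈ A, ∀ b ∈ B, ∀ π : G.Walk a b, π.IsPath → ∃ s ∈ S, s ∈ π.support
  balanced : α * (Fintype.card V : ℝ) ≤ min (A.card : ℝ) (B.card : ℝ)

/-- The class is hereditary and, for some constants `n₀` and `β₀ ≥ 1`, an `α`-balanced
vertex-separator of size at most `β₀ n ^ β` exists, and can be found in polynomial time, for each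
of its graphs with `n ≥ n₀` vertices. -/
def HasEfficientSeparators (𝒢 : GraphClass) (α β : ℝ) : Prop :=
  Hereditary 𝒢 ∧
  ∃ (n₀ : ℕ) (β₀ : ℝ), 1 ≤ β₀ ∧ ∃ (P : Prog) (p : Polynomial ℕ),
    ∀ (n : ℕ) (G : SimpleGraph (Fin n)), n₀ ≤ n → 𝒢 n G →
      ∃ S A B : Finset (Fin n), IsBalancedSeparator G α S A B ∧
        (S.card : ℝ) ≤ β₀ * (n : ℝ) ^ β ∧
        OutputsWithin P p (encodeGraph G)
          (.pair (encodeSet S) (.pair (encodeSet A) (encodeSet B)))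

/-! ### The problem -/

/-- Total weight of a walk. -/
def walkWeight {V : Type} {G : SimpleGraph V} (w : Sym2 V → ℚ≥0) {u v : V} (π : G.Walk u v) :
    ℚ≥0 :=
  (π.edges.map w).sum

/-- A path of minimum weight among all paths with the same endpoints. -/
def IsShortestPath {V : Type} {G : SimpleGraph V} (w : Sym2 V → ℚ≥0) {u v : V}
    (π : G.Walk u v) : Prop :=
  π.IsPath ∧ ∀ π' : G.Walk u v, π'.IsPath → walkWeight w π ≤ walkWeight w π'

/-- The edge `e` is monitored by the pair `x, y` of distinct vertices: it lies on all shortest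
paths between them. -/
def Monitors {V : Type} (G : SimpleGraph V) (w : Sym2 V → ℚ≥0) (x y : V) (e : Sym2 V) : Prop :=
  x ≠ y ∧ ∀ π : G.Walk x y, IsShortestPath w π → e ∈ π.edges

/-- An instance on `n` vertices. Only the weights of edges matter. -/
structure Instance (n : ℕ) where
  /-- the graph -/
  graph : SimpleGraph (Fin n)
  /-- the edge weights -/
  weight : Sym2 (Fin n) → ℚ≥0
  /-- the vertex costs -/
  cost : Fin n → ℕ
  cost_le_one : ∀ v, cost v ≤ 1
  /-- the edges to be monitored -/
  target : Finset (Sym2 (Fin n))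
  target_subset : ∀ e ∈ target, e ∈ graph.edgeSet

namespace Instance

variable {n : ℕ}

/-- `M` monitors every edge to be monitored. -/
def IsSolution (I : Instance n) (M : Finset (Fin n)) : Prop :=
  ∀ e ∈ I.target, ∃ x ∈ M, ∃ y ∈ M, Monitors I.graph I.weight x y e

/-- The cost of a set of vertices. -/
def costOf (I : Instance n) (M : Finset (Fin n)) : ℕ :=
  ∑ v ∈ M, I.cost v

open Classical in
/-- An instance is encoded by its number of vertices, the list of costs, and the matrix whose
entry at `(u, v)` is `0` if `u, v` are not adjacent, and otherwise consists of the weight of the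
edge (numerator and denominator) and a bit that tells whether it has to be monitored. -/
noncomputable def encode (I : Instance n) : Val :=
  .pair (.num n) (.pair (.ofList (List.ofFn fun v : Fin n => .num (I.cost v)))
    (.ofList (List.ofFn fun u : Fin n => .ofList (List.ofFn fun v : Fin n =>
      if I.graph.Adj u v then
        .pair (.pair (.num (I.weight s(u, v)).num) (.num (I.weight s(u, v)).den))
          (.num (if s(u, v) ∈ I.target then 1 else 0))
      else .num 0))))

end Instance

/-- There is a polynomial-time algorithm which, for every solvable instance whose graph is
connected and belongs to `𝒢`, outputs a solution `M` with
`c(M) ≤ ρ(c(V), n) * c(M')` for every solution `M'`, if `c(V) ≥ 2`, and an optimal solution in the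
degenerate case `c(V) ≤ 1`. -/
def HasPolyTimeApprox (𝒢 : GraphClass) (ρ : ℕ → ℕ → ℝ) : Prop :=
  ∃ (P : Prog) (p : Polynomial ℕ), ∀ (n : ℕ) (I : Instance n),
    𝒢 n I.graph → I.graph.Connected → (∃ M, I.IsSolution M) →
      ∃ M : Finset (Fin n), OutputsWithin P p I.encode (encodeSet M) ∧ I.IsSolution M ∧
        ∀ M' : Finset (Fin n), I.IsSolution M' →
          (2 ≤ I.costOf Finset.univ →
            (I.costOf M : ℝ) ≤ ρ (I.costOf Finset.univ) n * (I.costOf M' : ℝ)) ∧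
          (I.costOf Finset.univ ≤ 1 → I.costOf M ≤ I.costOf M')

end GMEG

/-! The algorithm is a divide and conquer over the set of cost-one vertices. A subset X of it is
handled with all vertices outside X available for free, and only vertices of X are paid for. Let a
solution O have o vertices in X. There are two ways to treat X. Greedy: the o² pairs from O ∩ X,
together with the free vertices, monitor everything, so repeatedly adding the best pair is a
set-cover greedy and pays O(o² log n). Separator: pay for a balanced separator S of the subgraph
induced by X and recurse on its sides A and B. The algorithm takes the greedy result if it costs at
most |S| and splits otherwise. Either way the amount paid at X itself is at most min(|S|, greedy),
hence at most the geometric mean √(|S| · 8 o² log n) ≤ √(log n) · √8 · √(β₀|X|^β) · o. This is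
linear in o, and it explains both √(log n) and the exponent β/2. Since O ∩ A and O ∩ B are disjoint
parts of O ∩ X, the costs of the two recursive calls are added without loss. A ratio √(log n) ·
Φ(|X|) is therefore achieved as soon as Φ(x) ≥ √8 · √(β₀x^β) + Φ(a) for a ≤ (1 - α)x. The solution
of this recurrence is a geometric sum if β > 0 and is proportional to the recursion depth, which is
logarithmic, if β = 0. The recursion is sound because solutions R_A ⊇ Aᶜ and R_B ⊇ Bᶜ intersect in a
solution: a shortest path through an edge near A can be shortened until its ends lie in the
intersection. Monitoring is decided by comparing the distance of the pair with and without the edge.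
Polynomial running time follows from a calculus of polynomial-time functions, whose main tool is a
left fold with polynomially bounded accumulators. The main lemmas are `PolyTimeOn.foldl`,
`Instance.IsSolution.inter`, `Instance.mon_raw`, `Instance.IsSolution.card_greedy_le`,
`Instance.IsSolution.card_greedy_le_of_separator` and `Instance.exists_isGood`. -/

namespace GMEG

/-! ### Polynomial-time computable functions between types with an encoding -/

/-- Types whose elements are encoded by values. -/
class Enc (α : Type) where
  /-- the encoding -/
  enc : α → Val

open Enc (enc)

instance : Enc Val := ⟨fun v => v⟩
instance : Enc ℕ := ⟨Val.num⟩
instance : Enc Bool := ⟨fun b => .num (if b then 1 else 0)⟩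
instance {α β : Type} [Enc α] [Enc β] : Enc (α × β) := ⟨fun x => .pair (enc x.1) (enc x.2)⟩
instance {α : Type} [Enc α] : Enc (List α) := ⟨fun l => .ofList (l.map enc)⟩

/-- The length of the encoding. -/
def esize {α : Type} [Enc α] (a : α) : ℕ := (enc a).size

variable {α β γ δ σ : Type} [Enc α] [Enc β] [Enc γ] [Enc δ] [Enc σ]

theorem eval_le_eval (p : Polynomial ℕ) {a b : ℕ} (h : a ≤ b) : p.eval a ≤ p.eval b := by
  rw [Polynomial.eval_eq_sum_range, Polynomial.eval_eq_sum_range]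
  gcongr

@[simp] theorem esize_prod (x : α × β) : esize x = esize x.1 + esize x.2 + 1 := rfl

@[simp] theorem esize_nil : esize ([] : List α) = 1 := rfl

@[simp] theorem esize_cons (a : α) (l : List α) : esize (a :: l) = esize a + esize l + 1 := rfl

theorem esize_nat (k : ℕ) : esize k = k.size + 1 := rfl

theorem esize_bool_le (b : Bool) : esize b ≤ 2 := by cases b <;> decide

theorem esize_list (l : List α) : esize l = (l.map esize).sum + l.length + 1 := by
  induction l with
  | nil => rfl
  | cons a l ih =>
    simp only [esize_cons, ih, List.map_cons, List.sum_cons, List.length_cons]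
    omega

theorem length_lt_esize (l : List α) : l.length < esize l := by
  rw [esize_list]
  omega

theorem esize_mem_lt {l : List α} {a : α} (h : a ∈ l) : esize a < esize l := by
  induction l with
  | nil => simp at h
  | cons b l ih =>
    rcases List.mem_cons.1 h with rfl | h
    · simp only [esize_cons]; omega
    · have := ih h
      simp only [esize_cons]; omega

theorem esize_list_le {l : List α} {B : ℕ} (h : ∀ a ∈ l, esize a ≤ B) :
    esize l ≤ l.length * (B + 1) + 1 := by
  induction l with
  | nil => simp
  | cons a l ih =>
    have h1 := ih fun b hb => h b (List.mem_cons_of_mem _ hb)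
    have h2 := h a List.mem_cons_self
    simp only [esize_cons, List.length_cons]
    nlinarith

theorem esize_le_of_sublist {l₁ l₂ : List α} (h : l₁.Sublist l₂) : esize l₁ ≤ esize l₂ := by
  rw [esize_list, esize_list]
  have h1 := (h.map esize).sum_le_sum (fun _ _ => Nat.zero_le _)
  have h2 := h.length_le
  omega

/-- `g` is bounded on `s` by a polynomial in the length of the encoding. -/
def PolyBdd (s : Set α) (g : α → ℕ) : Prop := ∃ p : Polynomial ℕ, ∀ a ∈ s, g a ≤ p.eval (esize a)

namespace PolyBdd

variable {s : Set α} {f g : α → ℕ}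

theorem mono (hg : PolyBdd s g) (h : ∀ a ∈ s, f a ≤ g a) : PolyBdd s f :=
  let ⟨p, hp⟩ := hg
  ⟨p, fun a ha => (h a ha).trans (hp a ha)⟩

theorem on (hg : PolyBdd Set.univ g) : PolyBdd s g :=
  let ⟨p, hp⟩ := hg
  ⟨p, fun a _ => hp a trivial⟩

theorem const (k : ℕ) : PolyBdd s fun _ => k := ⟨.C k, fun a _ => by simp⟩

theorem self : PolyBdd s fun a => esize a := ⟨.X, fun a _ => by simp⟩

theorem add (hf : PolyBdd s f) (hg : PolyBdd s g) : PolyBdd s fun a => f a + g a :=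
  let ⟨p, hp⟩ := hf
  let ⟨q, hq⟩ := hg
  ⟨p + q, fun a ha => by simpa using Nat.add_le_add (hp a ha) (hq a ha)⟩

theorem mul (hf : PolyBdd s f) (hg : PolyBdd s g) : PolyBdd s fun a => f a * g a :=
  let ⟨p, hp⟩ := hf
  let ⟨q, hq⟩ := hg
  ⟨p * q, fun a ha => by simpa using Nat.mul_le_mul (hp a ha) (hq a ha)⟩

theorem eval (p : Polynomial ℕ) (hf : PolyBdd s f) : PolyBdd s fun a => p.eval (f a) :=
  let ⟨q, hq⟩ := hf
  ⟨p.comp q, fun a ha => by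
    rw [Polynomial.eval_comp]
    exact eval_le_eval p (hq a ha)⟩

end PolyBdd

/-- On `s`, the function `f` is computed by a program in polynomial time, and the length of its
output is polynomially bounded. -/
def PolyTimeOn (s : Set α) (f : α → β) : Prop :=
  ∃ (P : Prog) (p : Polynomial ℕ), ∀ a ∈ s, ∃ t, Run P (enc a) (enc (f a)) t ∧
    t ≤ p.eval (esize a) ∧ esize (f a) ≤ p.eval (esize a)

/-- The function `f` is computable in polynomial time. -/
@[fun_prop]
def PolyTime (f : α → β) : Prop := PolyTimeOn Set.univ f

namespace PolyTimeOn

variable {s t : Set α} {f : α → β}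

theorem of_polyBdd {T : α → ℕ} (P : Prog) (hT : PolyBdd s T) (hf : PolyBdd s fun a => esize (f a))
    (h : ∀ a ∈ s, ∃ t, Run P (enc a) (enc (f a)) t ∧ t ≤ T a) : PolyTimeOn s f := by
  obtain ⟨p, hp⟩ := hT
  obtain ⟨q, hq⟩ := hf
  refine ⟨P, p + q, fun a ha => ?_⟩
  obtain ⟨t, h1, h2⟩ := h a ha
  have h3 := hp a ha
  have h4 : esize (f a) ≤ _ := hq a ha
  refine ⟨t, h1, ?_, ?_⟩ <;> simp only [Polynomial.eval_add] <;> omega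

theorem polyBdd (hf : PolyTimeOn s f) : PolyBdd s fun a => esize (f a) :=
  let ⟨_, p, h⟩ := hf
  ⟨p, fun a ha => let ⟨_, h'⟩ := h a ha; h'.2.2⟩

theorem mono (hf : PolyTimeOn t f) (h : s ⊆ t) : PolyTimeOn s f :=
  let ⟨P, p, hP⟩ := hf
  ⟨P, p, fun a ha => hP a (h ha)⟩

theorem congr {g : α → β} (hf : PolyTimeOn s f) (h : ∀ a ∈ s, f a = g a) : PolyTimeOn s g :=
  let ⟨P, p, hP⟩ := hf
  ⟨P, p, fun a ha => h a ha ▸ hP a ha⟩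

/-- This is why `PolyTimeOn` bounds the output length separately: values are shared, so iterating
`pair id id` yields a value exponentially longer than the running time, and the second program is
charged by the length of its input. -/
theorem comp {u : Set β} {g : β → γ} (hg : PolyTimeOn u g) (hf : PolyTimeOn s f)
    (h : ∀ a ∈ s, f a ∈ u) : PolyTimeOn s fun a => g (f a) := by
  obtain ⟨P, p, hP⟩ := hf
  obtain ⟨Q, q, hQ⟩ := hg
  refine ⟨.seq P Q, p + q.comp p + 1, fun a ha => ?_⟩
  obtain ⟨t, h1, h2, h3⟩ := hP a ha
  obtain ⟨t', h4, h5, h6⟩ := hQ _ (h a ha)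
  have h7 := eval_le_eval q h3
  refine ⟨_, .seq h1 h4, ?_, ?_⟩ <;>
  simp only [Polynomial.eval_add, Polynomial.eval_comp, Polynomial.eval_one] <;> omega

theorem prodMk {g : α → γ} (hf : PolyTimeOn s f) (hg : PolyTimeOn s g) :
    PolyTimeOn s fun a => (f a, g a) := by
  obtain ⟨P, p, hP⟩ := hf
  obtain ⟨Q, q, hQ⟩ := hg
  refine ⟨.pair P Q, p + q + 1, fun a ha => ?_⟩
  obtain ⟨t, h1, h2, h3⟩ := hP a ha
  obtain ⟨t', h4, h5, h6⟩ := hQ a ha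
  refine ⟨_, .pair h1 h4, ?_, ?_⟩ <;>
  simp only [Polynomial.eval_add, Polynomial.eval_one, esize_prod] <;> omega

theorem cond {c : α → Bool} {g : α → β} (hc : PolyTimeOn s c)
    (hf : PolyTimeOn {a | a ∈ s ∧ c a = true} f) (hg : PolyTimeOn {a | a ∈ s ∧ c a = false} g) :
    PolyTimeOn s fun a => cond (c a) (f a) (g a) := by
  obtain ⟨P, p, hP⟩ := hf
  obtain ⟨Q, q, hQ⟩ := hg
  obtain ⟨R, r, hR⟩ := hc
  refine ⟨.ite R P Q, p + q + r + 1, fun a ha => ?_⟩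
  obtain ⟨t, h1, h2, h3⟩ := hR a ha
  cases hca : c a
  · obtain ⟨t', h4, h5, h6⟩ := hQ a ⟨ha, hca⟩
    rw [hca] at h1
    simp only [hca, cond_false]
    refine ⟨_, .iteFalse h1 h4, ?_, ?_⟩ <;>
    simp only [Polynomial.eval_add, Polynomial.eval_one] <;> omega
  · obtain ⟨t', h4, h5, h6⟩ := hP a ⟨ha, hca⟩
    rw [hca] at h1
    simp only [hca, cond_true]
    refine ⟨_, .iteTrue h1 (by simp [enc]) h4, ?_, ?_⟩ <;>
    simp only [Polynomial.eval_add, Polynomial.eval_one] <;> omega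

/-- Iteration, as long as a condition holds, of a function with polynomially bounded orbits. -/
theorem iterate {s T : Set σ} {c : σ → Bool} {f : σ → σ} {k g : σ → ℕ} (hc : PolyTimeOn T c)
    (hf : PolyTimeOn {x | x ∈ T ∧ c x = true} f) (hk : PolyBdd s k) (hg : PolyBdd s g)
    (h : ∀ a ∈ s, ∀ j ≤ k a, f^[j] a ∈ T ∧ esize (f^[j] a) ≤ g a ∧
      (c (f^[j] a) = true ↔ j < k a)) : PolyTimeOn s fun a => f^[k a] a := by
  obtain ⟨P, p, hP⟩ := hf
  obtain ⟨R, r, hR⟩ := hc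
  refine of_polyBdd (T := fun a => (k a + 1) * (r.eval (g a) + p.eval (g a) + 1)) (.loop R P)
    ((hk.add (.const 1)).mul (((hg.eval r).add (hg.eval p)).add (.const 1)))
    (hg.mono fun a ha => (h a ha _ le_rfl).2.1) fun a ha => ?_
  -- Induction on the number `m` of remaining iterations, because a run of `loop` is built from its
  -- end.
  have key : ∀ m ≤ k a, ∃ t, Run (.loop R P) (enc (f^[k a - m] a)) (enc (f^[k a] a)) t ∧
      t ≤ (m + 1) * (r.eval (g a) + p.eval (g a) + 1) := by
    intro m
    induction m with
    | zero =>
      intro _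
      obtain ⟨h1, h2, h3⟩ := h a ha _ le_rfl
      obtain ⟨t, h4, h5, -⟩ := hR _ h1
      have h6 : c (f^[k a] a) = false := by simpa using h3
      rw [h6] at h4
      refine ⟨_, .loopStop h4, ?_⟩
      have := eval_le_eval r h2
      simp only [Nat.zero_add, one_mul]; omega
    | succ m ih =>
      intro hm
      obtain ⟨t, h1, h2⟩ := ih (by omega)
      obtain ⟨h3, h4, h5⟩ := h a ha (k a - (m + 1)) (by omega)
      obtain ⟨t1, h6, h7, -⟩ := hR _ h3
      have h8 := h5.2 (by omega)
      obtain ⟨t2, h9, h10, -⟩ := hP _ ⟨h3, h8⟩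
      have h11 : k a - m = (k a - (m + 1)) + 1 := by omega
      rw [h11, Function.iterate_succ_apply'] at h1
      rw [h8] at h6
      refine ⟨_, .loopStep h6 (by simp [enc]) h9 h1, ?_⟩
      have := eval_le_eval r h4
      have := eval_le_eval p h4
      nlinarith
  simpa using key _ le_rfl

end PolyTimeOn

theorem PolyTime.on {s : Set α} {f : α → β} (h : PolyTime f) : PolyTimeOn s f := h.mono s.subset_univ

/-! ### Closure properties of polynomial-time functions. -/

namespace PolyTime

@[fun_prop]
theorem id : PolyTime (fun a : α => a) :=
  PolyTimeOn.of_polyBdd .id (.const 1) .self fun _ _ => ⟨1, .id _, le_rfl⟩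

@[fun_prop]
theorem comp {g : β → γ} {f : α → β} (hg : PolyTime g) (hf : PolyTime f) :
    PolyTime fun a => g (f a) :=
  PolyTimeOn.comp hg hf fun _ _ => trivial

@[fun_prop]
theorem prodMk {f : α → β} {g : α → γ} (hf : PolyTime f) (hg : PolyTime g) :
    PolyTime fun a => (f a, g a) :=
  PolyTimeOn.prodMk hf hg

theorem fst' : PolyTime (Prod.fst : α × β → α) :=
  PolyTimeOn.of_polyBdd .fst (.const 1) (PolyBdd.self.mono fun a _ => by simp; omega)
    fun _ _ => ⟨1, .fst _, le_rfl⟩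

theorem snd' : PolyTime (Prod.snd : α × β → β) :=
  PolyTimeOn.of_polyBdd .snd (.const 1) (PolyBdd.self.mono fun a _ => by simp; omega)
    fun _ _ => ⟨1, .snd _, le_rfl⟩

@[fun_prop]
theorem fst {f : α → β × γ} (hf : PolyTime f) : PolyTime fun a => (f a).1 := comp fst' hf

@[fun_prop]
theorem snd {f : α → β × γ} (hf : PolyTime f) : PolyTime fun a => (f a).2 := comp snd' hf

theorem exists_const (v : Val) : ∃ P t, ∀ x, Run P x v t := by
  induction v with
  | num k => exact ⟨.const k, _, fun x => .const k x⟩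
  | pair a b iha ihb =>
    obtain ⟨P, s, hP⟩ := iha
    obtain ⟨Q, t, hQ⟩ := ihb
    exact ⟨.pair P Q, _, fun x => .pair (hP x) (hQ x)⟩

@[fun_prop]
theorem const (b : β) : PolyTime fun _ : α => b := by
  obtain ⟨P, t, h⟩ := exists_const (enc b)
  exact PolyTimeOn.of_polyBdd P (.const t) (.const (esize b)) fun a _ => ⟨t, h _, le_rfl⟩

@[fun_prop]
theorem cond {c : α → Bool} {f g : α → β} (hc : PolyTime c) (hf : PolyTime f) (hg : PolyTime g) :
    PolyTime fun a => cond (c a) (f a) (g a) :=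
  PolyTimeOn.cond hc hf.on hg.on

/-! Arithmetic -/

theorem natSize_add_le (a b : ℕ) : (a + b).size ≤ a.size + b.size := by
  rcases Nat.eq_zero_or_pos a with rfl | ha
  · simp
  rcases Nat.eq_zero_or_pos b with rfl | hb
  · simp
  rw [Nat.size_le]
  have h1 := Nat.lt_size_self a
  have h2 := Nat.lt_size_self b
  rw [pow_add]
  nlinarith

theorem natSize_mul_le (a b : ℕ) : (a * b).size ≤ a.size + b.size := by
  rw [Nat.size_le, pow_add]
  have h1 := Nat.lt_size_self a
  have h2 := Nat.lt_size_self b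
  calc a * b ≤ a * 2 ^ b.size := Nat.mul_le_mul_left _ h2.le
    _ < _ := Nat.mul_lt_mul_of_pos_right h1 (by positivity)

theorem natSize_onNat_le (o : Arith) (a b : ℕ) : (o.onNat a b).size ≤ a.size + b.size := by
  cases o
  · exact natSize_add_le a b
  · exact (Nat.size_le_size (Nat.sub_le a b)).trans (Nat.le_add_right _ _)
  · exact natSize_mul_le a b
  · exact (Nat.size_le_size (Nat.div_le_self a b)).trans (Nat.le_add_right _ _)

theorem onNat (o : Arith) : PolyTime fun x : ℕ × ℕ => o.onNat x.1 x.2 :=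
  PolyTimeOn.of_polyBdd (.arith o) .self
    (PolyBdd.self.mono fun a _ => by
      have := natSize_onNat_le o a.1 a.2
      simp only [esize_prod, esize_nat]
      omega)
    fun x _ => ⟨_, .arith o _, by
      simp only [enc, Arith.cost, esize_prod, esize_nat]
      omega⟩

@[fun_prop]
theorem add {f g : α → ℕ} (hf : PolyTime f) (hg : PolyTime g) : PolyTime fun a => f a + g a :=
  comp (onNat .add) (prodMk hf hg)

@[fun_prop]
theorem sub {f g : α → ℕ} (hf : PolyTime f) (hg : PolyTime g) : PolyTime fun a => f a - g a :=
  comp (onNat .sub) (prodMk hf hg)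

@[fun_prop]
theorem mul {f g : α → ℕ} (hf : PolyTime f) (hg : PolyTime g) : PolyTime fun a => f a * g a :=
  comp (onNat .mul) (prodMk hf hg)

@[fun_prop]
theorem div {f g : α → ℕ} (hf : PolyTime f) (hg : PolyTime g) : PolyTime fun a => f a / g a :=
  comp (onNat .div) (prodMk hf hg)

end PolyTime

/-- Whether a value differs from `0`. -/
def Val.truthy : Val → Bool
  | .num 0 => false
  | _ => true

/-- The number stored in a leaf, and `0` on pairs. -/
def Val.toNat : Val → ℕ
  | .num k => k
  | _ => 0

/-- Comparison of numbers, as a Boolean. -/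
def natLt (a b : ℕ) : Bool := (Val.num (b - a)).truthy

@[simp] theorem natLt_iff {a b : ℕ} : natLt a b = true ↔ a < b := by
  unfold natLt
  rcases h : b - a with _ | k
  · simp [Val.truthy]; omega
  · simp [Val.truthy]; omega

namespace PolyTime

theorem truthy' : PolyTime Val.truthy :=
  PolyTimeOn.of_polyBdd (T := fun _ => 4) (.ite .id (.const 1) (.const 0)) (.const 4)
    (PolyBdd.mono (.const 2) fun a _ => esize_bool_le _) fun x _ => by
      by_cases h : x = .num 0
      · subst h
        exact ⟨_, .iteFalse (.id _) (.const 0 _), by decide⟩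
      · refine ⟨1 + (Nat.size 1 + 1) + 1, .iteTrue (.id _) h ?_, by decide⟩
        have : x.truthy = true := by
          cases x with
          | num k => cases k <;> simp_all [Val.truthy]
          | pair a b => rfl
        rw [this]
        exact .const 1 _

@[fun_prop]
theorem truthy {f : α → Val} (hf : PolyTime f) : PolyTime fun a => (f a).truthy := comp truthy' hf

/-- Adding `0` fixes a number and sends a pair to `0`, the default value of `Arith.apply`. -/
theorem toNat' : PolyTime Val.toNat :=
  PolyTimeOn.of_polyBdd (T := fun x => esize x + 5) (.seq (.pair .id (.const 0)) (.arith .add))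
    (PolyBdd.self.add (.const 5))
    (PolyBdd.self.mono fun x _ => by
      cases x with
      | num k => exact le_rfl
      | pair a b => simp only [Val.toNat, esize, enc, Val.size]; simp)
    fun x _ => by
      have h1 : Arith.add.apply (.pair x (.num 0)) = enc x.toNat := by cases x <;> rfl
      have h2 := Run.arith .add (.pair x (.num 0))
      rw [h1] at h2
      refine ⟨_, .seq (.pair (.id x) (.const 0 x)) h2, ?_⟩
      cases x <;> simp [Arith.cost, esize, enc, Val.size]
      omega

@[fun_prop]
theorem toNat {f : α → Val} (hf : PolyTime f) : PolyTime fun a => (f a).toNat := comp toNat' hf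

theorem valFst' : PolyTime Val.fst :=
  PolyTimeOn.of_polyBdd .fst (.const 1)
    (PolyBdd.self.mono fun x _ => by
      cases x with
      | num k => simp [esize, enc, Val.fst, Val.size]
      | pair a b => simp only [esize, enc, Val.fst, Val.size]; omega)
    fun x _ => ⟨1, .fst x, le_rfl⟩

@[fun_prop]
theorem valFst {f : α → Val} (hf : PolyTime f) : PolyTime fun a => (f a).fst := comp valFst' hf

theorem valSnd' : PolyTime Val.snd :=
  PolyTimeOn.of_polyBdd .snd (.const 1)
    (PolyBdd.self.mono fun x _ => by
      cases x with
      | num k => simp [esize, enc, Val.snd, Val.size]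
      | pair a b => simp only [esize, enc, Val.snd, Val.size]; omega)
    fun x _ => ⟨1, .snd x, le_rfl⟩

@[fun_prop]
theorem valSnd {f : α → Val} (hf : PolyTime f) : PolyTime fun a => (f a).snd := comp valSnd' hf

theorem ofNat' : PolyTime Val.num :=
  PolyTimeOn.of_polyBdd .id (.const 1) PolyBdd.self fun _ _ => ⟨1, .id _, le_rfl⟩

@[fun_prop]
theorem ofNat {f : α → ℕ} (hf : PolyTime f) : PolyTime fun a => Val.num (f a) := comp ofNat' hf

@[fun_prop]
theorem natLt {f g : α → ℕ} (hf : PolyTime f) (hg : PolyTime g) :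
    PolyTime fun a => natLt (f a) (g a) := by
  unfold GMEG.natLt
  fun_prop

theorem not' : PolyTime Bool.not := by
  have : Bool.not = fun b => _root_.cond b false true := by funext b; cases b <;> rfl
  rw [this]
  fun_prop

@[fun_prop]
theorem not {f : α → Bool} (hf : PolyTime f) : PolyTime fun a => !(f a) := comp not' hf

theorem and' : PolyTime fun x : Bool × Bool => x.1 && x.2 := by
  have : (fun x : Bool × Bool => x.1 && x.2) = fun x => _root_.cond x.1 x.2 false := by
    funext ⟨a, b⟩; cases a <;> rfl
  rw [this]
  fun_prop

@[fun_prop]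
theorem and {f g : α → Bool} (hf : PolyTime f) (hg : PolyTime g) : PolyTime fun a => f a && g a :=
  comp and' (prodMk hf hg)

theorem or' : PolyTime fun x : Bool × Bool => x.1 || x.2 := by
  have : (fun x : Bool × Bool => x.1 || x.2) = fun x => _root_.cond x.1 true x.2 := by
    funext ⟨a, b⟩; cases a <;> rfl
  rw [this]
  fun_prop

@[fun_prop]
theorem or {f g : α → Bool} (hf : PolyTime f) (hg : PolyTime g) : PolyTime fun a => f a || g a :=
  comp or' (prodMk hf hg)

end PolyTime

/-- Equality of numbers, as a Boolean. -/
def natEq (a b : ℕ) : Bool := !(natLt a b || natLt b a)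

@[simp] theorem natEq_iff {a b : ℕ} : natEq a b = true ↔ a = b := by
  rw [natEq, Bool.not_eq_true', ← Bool.not_eq_true, Bool.or_eq_true, natLt_iff, natLt_iff]
  omega

@[fun_prop]
theorem PolyTime.natEq {f g : α → ℕ} (hf : PolyTime f) (hg : PolyTime g) :
    PolyTime fun a => natEq (f a) (g a) := by
  unfold GMEG.natEq
  fun_prop

end GMEG

namespace GMEG
open Enc (enc)
variable {α β γ δ σ : Type} [Enc α] [Enc β] [Enc γ] [Enc δ] [Enc σ]

/-! ### List processing in polynomial time -/

theorem PolyTime.enc : PolyTime (enc : α → Val) :=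
  PolyTimeOn.of_polyBdd .id (.const 1) PolyBdd.self fun _ _ => ⟨1, .id _, le_rfl⟩

/-- Whether a list is non-empty. -/
def isCons : List α → Bool
  | [] => false
  | _ :: _ => true

theorem isCons_eq (l : List α) : isCons l = (enc l).truthy := by cases l <;> rfl

@[fun_prop]
theorem PolyTime.isCons {l : δ → List α} (hl : PolyTime l) : PolyTime fun d => isCons (l d) := by
  simp only [isCons_eq]
  exact truthy (comp PolyTime.enc hl)

/-- One step of a left fold; the state consists of a context, the remaining list and the
accumulator. -/
def foldStep (f : δ → β → α → β) (x : δ × (List α × β)) : δ × (List α × β) :=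
  match x.2.1 with
  | [] => x
  | a :: l => (x.1, (l, f x.1 x.2.2 a))

omit [Enc α] [Enc β] [Enc δ] in
theorem foldStep_iterate (f : δ → β → α → β) (d : δ) (j : ℕ) (l : List α) (b : β) :
    (foldStep f)^[j] (d, (l, b)) = (d, (l.drop j, (l.take j).foldl (f d) b)) := by
  induction j generalizing l b with
  | zero => simp
  | succ j ih =>
    rw [Function.iterate_succ_apply]
    cases l with
    | nil =>
      have : foldStep f (d, (([] : List α), b)) = (d, ([], b)) := rfl
      rw [this, ih]
      simp
    | cons a l =>
      have : foldStep f (d, (a :: l, b)) = (d, (l, f d b a)) := rfl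
      rw [this, ih]
      simp

theorem PolyTimeOn.foldStep {s : Set (δ × (List α × β))} {f : δ → β → α → β}
    (hf : PolyTimeOn {y : δ × (β × α) | ∃ x ∈ s, ∃ l, x = (y.1, (y.2.2 :: l, y.2.1))}
      fun y => f y.1 y.2.1 y.2.2) :
    PolyTimeOn {x | x ∈ s ∧ isCons x.2.1 = true} (foldStep f) := by
  obtain ⟨P, p, hP⟩ := hf
  refine of_polyBdd (T := fun x => p.eval (esize x) + 30)
    (.pair .fst (.pair (.seq .snd (.seq .fst .snd)) (.seq (.pair .fst
      (.pair (.seq .snd .snd) (.seq .snd (.seq .fst .fst)))) P)))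
    ((PolyBdd.self.eval p).add (.const 30)) ((PolyBdd.self.eval p).add PolyBdd.self |>.mono ?_) ?_
  · rintro ⟨d, _ | ⟨a, l⟩, b⟩ ⟨h1, h2⟩
    · cases h2
    obtain ⟨t, h3, h4, h5⟩ := hP (d, (b, a)) ⟨_, h1, l, rfl⟩
    have h6 : p.eval (esize (d, (b, a))) ≤ p.eval (esize (d, (a :: l, b))) :=
      eval_le_eval p (by simp only [esize_prod, esize_cons]; omega)
    show esize (d, (l, f d b a)) ≤ _
    simp only [esize_prod, esize_cons] at h5 h6 ⊢
    omega
  · rintro ⟨d, _ | ⟨a, l⟩, b⟩ ⟨h1, h2⟩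
    · cases h2
    obtain ⟨t, h3, h4, h5⟩ := hP (d, (b, a)) ⟨_, h1, l, rfl⟩
    have h6 : p.eval (esize (d, (b, a))) ≤ p.eval (esize (d, (a :: l, b))) :=
      eval_le_eval p (by simp only [esize_prod, esize_cons]; omega)
    refine ⟨_, .pair (.fst _) (.pair (.seq (.snd _) (.seq (.fst _) (.snd _)))
      (.seq (.pair (.fst _) (.pair (.seq (.snd _) (.snd _))
        (.seq (.snd _) (.seq (.fst _) (.fst _))))) h3)), ?_⟩
    show _ ≤ p.eval (esize (d, (a :: l, b))) + 30
    omega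

/-- The recursion principle behind all later running-time bounds. The step function and the length
bound are only needed at accumulators reached after a prefix of the list. Working relative to `s`
matters because the separator routine is polynomial only on graphs of the class. -/
theorem PolyTimeOn.foldl {s : Set δ} {l : δ → List α} {b : δ → β} {f : δ → β → α → β} {g : δ → ℕ}
    (hl : PolyTimeOn s l) (hb : PolyTimeOn s b)
    (hf : PolyTimeOn {y : δ × (β × α) | y.1 ∈ s ∧
      ∃ l₁ l₂, l y.1 = l₁ ++ y.2.2 :: l₂ ∧ y.2.1 = l₁.foldl (f y.1) (b y.1)}
      fun y => f y.1 y.2.1 y.2.2)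
    (hg : PolyBdd s g)
    (h : ∀ d ∈ s, ∀ l₁ l₂, l d = l₁ ++ l₂ → esize (l₁.foldl (f d) (b d)) ≤ g d) :
    PolyTimeOn s fun d => (l d).foldl (f d) (b d) := by
  let S : Set (δ × (List α × β)) := {x | x.1 ∈ s ∧ x.2.1 = l x.1 ∧ x.2.2 = b x.1}
  -- The loop invariant: states reached after processing some prefix `l₁`.
  let T : Set (δ × (List α × β)) := {x | x.1 ∈ s ∧ ∃ l₁, l x.1 = l₁ ++ x.2.1 ∧
    x.2.2 = l₁.foldl (f x.1) (b x.1)}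
  have hF : PolyTimeOn {x | x ∈ T ∧ isCons x.2.1 = true} (GMEG.foldStep f) := by
    refine PolyTimeOn.foldStep (hf.mono ?_)
    rintro ⟨d, b', a⟩ ⟨x, ⟨h1, l₁, h2, h3⟩, l', rfl⟩
    exact ⟨h1, l₁, l', h2, h3⟩
  obtain ⟨q, hq⟩ := hg
  have key : PolyTimeOn S fun x => (GMEG.foldStep f)^[x.2.1.length] x := by
    refine iterate (c := fun x => isCons x.2.1) (T := T)
      (g := fun x => esize x + q.eval (esize x) + 1)
      (PolyTime.on (by fun_prop)) hF ?_ ?_ ?_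
    · exact PolyBdd.self.mono fun x _ => by
        have := length_lt_esize x.2.1
        simp only [esize_prod]
        omega
    · exact (PolyBdd.self.add (PolyBdd.self.eval q)).add (.const 1)
    · rintro ⟨d, l', b'⟩ ⟨h1, h2, h3⟩ j hj
      dsimp only at h1 h2 h3 hj ⊢
      subst h2 h3
      rw [foldStep_iterate]
      refine ⟨⟨h1, (l d).take j, by simp, rfl⟩, ?_, ?_⟩
      · have h4 := h d h1 ((l d).take j) ((l d).drop j) (by simp)
        have h5 := hq d h1
        have h6 := eval_le_eval q (show esize d ≤ esize (d, (l d, b d)) by simp; omega)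
        have h7 := esize_le_of_sublist (List.drop_sublist j (l d))
        simp only [esize_prod] at h6 ⊢
        omega
      · dsimp only
        rcases lt_or_eq_of_le hj with h4 | h4
        · have h5 : (l d).drop j ≠ [] := by simpa using h4
          rcases h6 : (l d).drop j with _ | ⟨a, l'⟩
          · exact absurd h6 h5
          · simp [isCons, h4]
        · subst h4
          simp [isCons]
  have h2 : PolyTimeOn s fun d => ((GMEG.foldStep f)^[(l d).length] (d, (l d, b d))).2.2 :=
    ((PolyTime.on (s := Set.univ) (f := fun x : δ × (List α × β) => x.2.2) (by fun_prop)).comp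
      key fun _ _ => trivial).comp (((PolyTime.on (by fun_prop)).prodMk (hl.prodMk hb)))
      fun d hd => ⟨hd, rfl, rfl⟩
  refine h2.congr fun d _ => ?_
  rw [foldStep_iterate]
  simp

namespace PolyTime

theorem foldl {l : δ → List α} {b : δ → β} {f : δ → β → α → β} {g : δ → ℕ}
    (hl : PolyTime l) (hb : PolyTime b) (hf : PolyTime fun y : δ × (β × α) => f y.1 y.2.1 y.2.2)
    (hg : PolyBdd Set.univ g)
    (h : ∀ d, ∀ l₁ l₂, l d = l₁ ++ l₂ → esize (l₁.foldl (f d) (b d)) ≤ g d) :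
    PolyTime fun d => (l d).foldl (f d) (b d) :=
  PolyTimeOn.foldl hl hb hf.on hg fun d _ => h d

theorem cons' : PolyTime fun x : α × List α => x.1 :: x.2 :=
  PolyTimeOn.of_polyBdd .id (.const 1) PolyBdd.self fun _ _ => ⟨1, .id _, le_rfl⟩

@[fun_prop]
theorem cons {f : δ → α} {l : δ → List α} (hf : PolyTime f) (hl : PolyTime l) :
    PolyTime fun d => f d :: l d :=
  comp cons' (prodMk hf hl)

@[fun_prop]
theorem reverse {l : δ → List α} (hl : PolyTime l) : PolyTime fun d => (l d).reverse := by
  have h (l : List α) : l.reverse = l.foldl (fun acc a => a :: acc) [] := by simp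
  have : PolyTime fun l : List α => l.foldl (fun acc a => a :: acc) [] := by
    refine foldl (f := fun _ acc a => a :: acc) id (const _) (by fun_prop) .self fun d l₁ l₂ h => ?_
    simp only [List.foldl_flip_cons_eq_append', List.append_nil]
    rw [esize_list, List.map_reverse, List.sum_reverse, List.length_reverse, ← esize_list]
    rw [h]
    exact esize_le_of_sublist (List.sublist_append_left _ _)
  simp only [h]
  exact comp this hl

@[fun_prop]
theorem map {l : δ → List α} {f : δ → α → β} (hl : PolyTime l)
    (hf : PolyTime fun x : δ × α => f x.1 x.2) : PolyTime fun d => (l d).map (f d) := by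
  have h (d : δ) (l : List α) (b : List β) :
      l.foldl (fun acc a => f d a :: acc) b = (l.map (f d)).reverse ++ b := by
    induction l generalizing b with
    | nil => rfl
    | cons a l ih => simp [ih]
  obtain ⟨p, hp⟩ := hf.polyBdd
  have key : PolyTime fun d => (l d).foldl (fun acc a => f d a :: acc) [] := by
    refine foldl (f := fun d acc a => f d a :: acc)
      (g := fun d => esize (l d) * (p.eval (esize d + esize (l d) + 1) + 1) + 1)
      hl (const _) (by fun_prop) ?_ fun d l₁ l₂ h' => ?_
    · exact (hl.polyBdd.mul (((PolyBdd.self.add hl.polyBdd).add (.const 1)).eval p |>.add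
        (.const 1))).add (.const 1)
    · rw [h]
      refine (esize_list_le (B := p.eval (esize d + esize (l d) + 1)) ?_).trans ?_
      · intro b hb
        simp only [List.append_nil, List.mem_reverse, List.mem_map] at hb
        obtain ⟨a, ha, rfl⟩ := hb
        refine (hp (d, a) trivial).trans (eval_le_eval p ?_)
        have : a ∈ l d := by rw [h']; exact List.mem_append_left _ ha
        have := esize_mem_lt this
        simp only [esize_prod]
        omega
      · have h2 : l₁.length ≤ esize (l d) := by
          have := length_lt_esize (l d)
          rw [h', List.length_append] at this
          rw [h']
          omega
        simp only [List.append_nil, List.length_reverse, List.length_map]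
        gcongr
  have h2 : (fun d => (l d).map (f d)) =
      fun d => ((l d).foldl (fun acc a => f d a :: acc) []).reverse := by
    funext d
    simp [h]
  rw [h2]
  exact reverse key

theorem esize_range_le {n k : ℕ} (h : n ≤ k) : esize (List.range n) ≤ k * (k + 2) + 1 := by
  have h1 : ∀ a ∈ List.range n, esize a ≤ k + 1 := fun a ha => by
    rw [esize_nat]
    have h2 : a.size ≤ a := Nat.size_le.2 Nat.lt_two_pow_self
    have := List.mem_range.1 ha
    omega
  have := esize_list_le h1
  rw [List.length_range] at this
  nlinarith

@[fun_prop]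
theorem range_length {l : δ → List α} (hl : PolyTime l) :
    PolyTime fun d => List.range (l d).length := by
  have h (l : List α) : l.foldl (fun (x : ℕ × List ℕ) _ => (x.1 + 1, x.1 :: x.2)) (0, []) =
      (l.length, (List.range l.length).reverse) := by
    induction l using List.reverseRecOn with
    | nil => rfl
    | append_singleton l a ih =>
      simp [List.foldl_append, ih, List.range_succ]
  have key : PolyTime fun l : List α =>
      l.foldl (fun (x : ℕ × List ℕ) _ => (x.1 + 1, x.1 :: x.2)) (0, []) := by
    refine foldl (f := fun _ (x : ℕ × List ℕ) _ => (x.1 + 1, x.1 :: x.2))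
      (g := fun l => (esize l + 1) + (esize l * (esize l + 2) + 1) + 1)
      id (const _) (by fun_prop) ?_ fun l l₁ l₂ h' => ?_
    · exact ((PolyBdd.self.add (.const 1)).add ((PolyBdd.self.mul
        (PolyBdd.self.add (.const 2))).add (.const 1))).add (.const 1)
    · have h2 := length_lt_esize l
      have h3 : l₁.length ≤ l.length := by rw [h']; simp
      rw [h, esize_prod]
      have h4 : esize (List.range l₁.length).reverse = esize (List.range l₁.length) := by
        rw [esize_list, List.map_reverse, List.sum_reverse, List.length_reverse, ← esize_list]
      have h5 := esize_range_le (n := l₁.length) (k := esize l) (by omega)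
      have h6 : l₁.length.size ≤ l₁.length := Nat.size_le.2 Nat.lt_two_pow_self
      simp only [h4, esize_nat]
      omega
  have h2 : (fun d => List.range (l d).length) = fun d =>
      ((l d).foldl (fun (x : ℕ × List ℕ) _ => (x.1 + 1, x.1 :: x.2)) (0, [])).2.reverse := by
    funext d
    simp [h]
  rw [h2]
  exact reverse (snd (comp key hl))

omit [Enc α] in
theorem esize_foldl_le {f : β → α → β} {b : β} {l : List α} {B : ℕ} (hb : esize b ≤ B)
    (h : ∀ b, ∀ a ∈ l, esize b ≤ B → esize (f b a) ≤ B) : esize (l.foldl f b) ≤ B := by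
  induction l generalizing b with
  | nil => exact hb
  | cons a l ih =>
    exact ih (h b a List.mem_cons_self hb) fun b a' ha => h b a' (List.mem_cons_of_mem _ ha)

@[fun_prop]
theorem getD {l : δ → List α} {i : δ → ℕ} {e : δ → α} (hl : PolyTime l) (hi : PolyTime i)
    (he : PolyTime e) : PolyTime fun d => (l d).getD (i d) (e d) := by
  have h (i : ℕ) (e : α) (l : List α) : l.foldl (fun (x : ℕ × α) a =>
      (x.1 + 1, _root_.cond (GMEG.natEq x.1 i) a x.2)) (0, e) = (l.length, l.getD i e) := by
    induction l using List.reverseRecOn with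
    | nil => rfl
    | append_singleton l a ih =>
      rw [List.foldl_append, ih]
      by_cases h1 : l.length = i
      · subst h1
        have h2 : GMEG.natEq l.length l.length = true := natEq_iff.2 rfl
        simp [List.getD_eq_getElem?_getD, h2]
      · have h2 : GMEG.natEq l.length i = false := by
          rw [← Bool.not_eq_true, natEq_iff]
          exact h1
        rcases lt_or_gt_of_ne h1 with h3 | h3
        · simp [List.getD_eq_getElem?_getD, h2, h3, h3.le]
        · simp [List.getD_eq_getElem?_getD, h2, List.getElem?_append_left, h3]
  have key : PolyTime fun d => (l d).foldl (fun (x : ℕ × α) a =>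
      (x.1 + 1, _root_.cond (GMEG.natEq x.1 (i d)) a x.2)) (0, e d) := by
    refine foldl (f := fun d (x : ℕ × α) a =>
      (x.1 + 1, _root_.cond (GMEG.natEq x.1 (i d)) a x.2))
      (g := fun d => (esize (l d) + 1) + (esize (l d) + esize (e d)) + 1)
      hl (by fun_prop) (by fun_prop) ?_ fun d l₁ l₂ h' => ?_
    · exact ((hl.polyBdd.add (.const 1)).add (hl.polyBdd.add he.polyBdd)).add (.const 1)
    · rw [h, esize_prod, esize_nat]
      have h2 := length_lt_esize (l d)
      have h3 : l₁.length ≤ (l d).length := by rw [h']; simp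
      have h6 : l₁.length.size ≤ l₁.length := Nat.size_le.2 Nat.lt_two_pow_self
      have h7 : esize (l₁.getD (i d) (e d)) ≤ esize (l d) + esize (e d) := by
        rcases lt_or_ge (i d) l₁.length with h8 | h8
        · have h9 : l₁.getD (i d) (e d) ∈ l d := by
            rw [h']
            apply List.mem_append_left
            rw [List.getD_eq_getElem _ _ h8]
            exact List.getElem_mem h8
          have := esize_mem_lt h9
          omega
        · rw [List.getD_eq_default _ _ h8]
          omega
      simp only
      omega
  have h2 : (fun d => (l d).getD (i d) (e d)) = fun d => ((l d).foldl (fun (x : ℕ × α) a =>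
      (x.1 + 1, _root_.cond (GMEG.natEq x.1 (i d)) a x.2)) (0, e d)).2 := by
    funext d
    rw [h]
  rw [h2]
  exact snd key

theorem sum' : PolyTime (List.sum : List ℕ → ℕ) := by
  have h1 (l : List ℕ) : esize l.sum ≤ esize l := by
    induction l with
    | nil => simp [esize_nat]
    | cons a l ih =>
      have := natSize_add_le a l.sum
      simp only [List.sum_cons, esize_cons, esize_nat] at ih ⊢
      omega
  have h2 (l : List ℕ) : l.sum = l.foldl (· + ·) 0 := by rw [List.sum_eq_foldl]
  have : PolyTime fun l : List ℕ => l.foldl (· + ·) 0 := by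
    refine foldl (f := fun _ (x y : ℕ) => x + y) id (const _) (by fun_prop) .self
      fun d l₁ l₂ h => ?_
    rw [← h2, h]
    exact (h1 _).trans (esize_le_of_sublist (List.sublist_append_left _ _))
  have h3 : (List.sum : List ℕ → ℕ) = _ := funext h2
  rw [h3]
  exact this

@[fun_prop]
theorem sum {l : δ → List ℕ} (hl : PolyTime l) : PolyTime fun d => (l d).sum := comp sum' hl

/-- Bit lengths are subadditive under multiplication, so every partial product is about as short as
the list. This keeps a common denominator of all weights polynomially long. -/
theorem prod' : PolyTime (List.prod : List ℕ → ℕ) := by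
  have h1 (l : List ℕ) : esize l.prod ≤ esize l + 1 := by
    induction l with
    | nil => simp [esize_nat]
    | cons a l ih =>
      have := natSize_mul_le a l.prod
      simp only [List.prod_cons, esize_cons, esize_nat] at ih ⊢
      omega
  have h2 (l : List ℕ) : l.prod = l.foldl (· * ·) 1 := by rw [List.prod_eq_foldl]
  have : PolyTime fun l : List ℕ => l.foldl (· * ·) 1 := by
    refine foldl (f := fun _ (x y : ℕ) => x * y) id (const _) (by fun_prop)
      (PolyBdd.self.add (.const 1)) fun d l₁ l₂ h => ?_
    rw [← h2, h]
    have := esize_le_of_sublist (List.sublist_append_left l₁ l₂)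
    have := h1 l₁
    omega
  have h3 : (List.prod : List ℕ → ℕ) = _ := funext h2
  rw [h3]
  exact this

@[fun_prop]
theorem prod {l : δ → List ℕ} (hl : PolyTime l) : PolyTime fun d => (l d).prod := comp prod' hl

@[fun_prop]
theorem any {l : δ → List α} {f : δ → α → Bool} (hl : PolyTime l)
    (hf : PolyTime fun x : δ × α => f x.1 x.2) : PolyTime fun d => (l d).any (f d) := by
  have h (d : δ) (l : List α) (b : Bool) :
      l.foldl (fun acc a => acc || f d a) b = (b || l.any (f d)) := by
    induction l generalizing b with
    | nil => simp
    | cons a l ih => simp [ih, Bool.or_assoc]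
  have key : PolyTime fun d => (l d).foldl (fun acc a => acc || f d a) false :=
    foldl (f := fun d acc a => acc || f d a) hl (const _) (by fun_prop) (.const 2)
      fun d l₁ l₂ h => esize_bool_le _
  simpa only [h, Bool.false_or] using key

@[fun_prop]
theorem filter {l : δ → List α} {f : δ → α → Bool} (hl : PolyTime l)
    (hf : PolyTime fun x : δ × α => f x.1 x.2) : PolyTime fun d => (l d).filter (f d) := by
  have h (d : δ) (l : List α) (b : List α) :
      l.foldl (fun acc a => _root_.cond (f d a) (a :: acc) acc) b =
        (l.filter (f d)).reverse ++ b := by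
    induction l generalizing b with
    | nil => rfl
    | cons a l ih => cases h : f d a <;> simp [ih, h]
  have key : PolyTime fun d => (l d).foldl (fun acc a => _root_.cond (f d a) (a :: acc) acc) [] := by
    refine foldl (f := fun d acc a => _root_.cond (f d a) (a :: acc) acc)
      hl (const _) (by fun_prop) hl.polyBdd fun d l₁ l₂ h' => ?_
    rw [h, List.append_nil, esize_list, List.map_reverse, List.sum_reverse, List.length_reverse,
      ← esize_list, h']
    exact esize_le_of_sublist (List.filter_sublist.trans (List.sublist_append_left _ _))
  have h2 : (fun d => (l d).filter (f d)) =
      fun d => ((l d).foldl (fun acc a => _root_.cond (f d a) (a :: acc) acc) []).reverse := by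
    funext d
    simp [h]
  rw [h2]
  exact reverse key

@[fun_prop]
theorem append {l₁ l₂ : δ → List α} (h₁ : PolyTime l₁) (h₂ : PolyTime l₂) :
    PolyTime fun d => l₁ d ++ l₂ d := by
  have h (d : δ) : l₁ d ++ l₂ d = (l₁ d).reverse.foldl (fun acc a => a :: acc) (l₂ d) := by simp
  simp only [h]
  refine foldl (f := fun _ acc a => a :: acc) (reverse h₁) h₂ (by fun_prop)
    (((reverse h₁).polyBdd.add h₂.polyBdd).add (.const 1)) fun d l l' h' => ?_
  rw [h']
  simp only [List.foldl_flip_cons_eq_append']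
  simp only [esize_list, List.map_append, List.map_reverse, List.sum_append, List.sum_reverse,
    List.length_append, List.length_reverse]
  omega

/-- The second component of `num 0` is again `num 0`, which agrees with the tail of the empty list.
-/
theorem tail' : PolyTime (List.tail : List α → List α) := by
  have h (l : List α) : (GMEG.Enc.enc l).snd = GMEG.Enc.enc l.tail := by cases l <;> rfl
  refine PolyTimeOn.of_polyBdd .snd (.const 1)
    (PolyBdd.self.mono fun l _ => esize_le_of_sublist (List.tail_sublist l)) fun l _ => ⟨1, ?_, le_rfl⟩
  rw [← h]
  exact .snd _

@[fun_prop]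
theorem tail {l : δ → List α} (hl : PolyTime l) : PolyTime fun d => (l d).tail := comp tail' hl

@[fun_prop]
theorem length {l : δ → List α} (hl : PolyTime l) : PolyTime fun d => (l d).length := by
  have h (d : δ) : (l d).length = ((l d).map fun _ => 1).sum := by simp
  simp only [h]
  fun_prop

end PolyTime

/-- Minimum of a number and a list of numbers. -/
def minList (b : ℕ) (l : List ℕ) : ℕ := l.foldl (fun x y => cond (natLt y x) y x) b

/-- The first element of `b :: l` with the least key. -/
def argminList (key : α → ℕ) (b : α) (l : List α) : α :=
  l.foldl (fun x y => cond (natLt (key y) (key x)) y x) b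

namespace PolyTime

@[fun_prop]
theorem argminList {l : δ → List α} {key : δ → α → ℕ} {b : δ → α}
    (hkey : PolyTime fun x : δ × α => key x.1 x.2) (hb : PolyTime b) (hl : PolyTime l) :
    PolyTime fun d => argminList (key d) (b d) (l d) := by
  have h1 : PolyTime fun y : δ × (α × α) => key y.1 y.2.2 :=
    comp hkey (f := fun y : δ × (α × α) => (y.1, y.2.2)) (by fun_prop)
  have h2 : PolyTime fun y : δ × (α × α) => key y.1 y.2.1 :=
    comp hkey (f := fun y : δ × (α × α) => (y.1, y.2.1)) (by fun_prop)
  refine foldl (f := fun d x y => _root_.cond (GMEG.natLt (key d y) (key d x)) y x) hl hb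
    (cond (natLt h1 h2) (by fun_prop) (by fun_prop)) (hl.polyBdd.add hb.polyBdd)
    fun d l₁ l₂ h => ?_
  refine esize_foldl_le (by omega) fun x y hy hx => ?_
  have : y ∈ l d := by rw [h]; exact List.mem_append_left _ hy
  have := esize_mem_lt this
  cases GMEG.natLt (key d y) (key d x) <;> simp only [cond_true, cond_false] <;> omega

@[fun_prop]
theorem minList {l : δ → List ℕ} {b : δ → ℕ} (hb : PolyTime b) (hl : PolyTime l) :
    PolyTime fun d => minList (b d) (l d) :=
  argminList (key := fun _ x => x) (by fun_prop) hb hl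

end PolyTime

theorem minList_le (b : ℕ) (l : List ℕ) : minList b l ≤ b ∧ ∀ a ∈ l, minList b l ≤ a := by
  induction l generalizing b with
  | nil => simp [minList]
  | cons c l ih =>
    obtain ⟨h1, h2⟩ := ih (cond (natLt c b) c b)
    have h3 : minList b (c :: l) = minList (cond (natLt c b) c b) l := rfl
    have h4 : cond (natLt c b) c b ≤ b ∧ cond (natLt c b) c b ≤ c := by
      cases h : natLt c b
      · rw [← Bool.not_eq_true, natLt_iff] at h
        simp only [cond_false]; omega
      · rw [natLt_iff] at h
        simp only [cond_true]; omega
    rw [h3]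
    refine ⟨h1.trans h4.1, fun a ha => ?_⟩
    rcases List.mem_cons.1 ha with rfl | ha
    · exact h1.trans h4.2
    · exact h2 a ha

theorem minList_mem (b : ℕ) (l : List ℕ) : minList b l = b ∨ minList b l ∈ l := by
  induction l generalizing b with
  | nil => simp [minList]
  | cons c l ih =>
    have h3 : minList b (c :: l) = minList (cond (natLt c b) c b) l := rfl
    rw [h3, List.mem_cons]
    rcases ih (cond (natLt c b) c b) with h | h
    · rw [h]
      cases natLt c b <;> simp
    · exact .inr (.inr h)

omit [Enc α] in
theorem argminList_mem (key : α → ℕ) (b : α) (l : List α) :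
    argminList key b l = b ∨ argminList key b l ∈ l := by
  induction l generalizing b with
  | nil => simp [argminList]
  | cons c l ih =>
    have h3 : argminList key b (c :: l) = argminList key (cond (natLt (key c) (key b)) c b) l := rfl
    rw [h3, List.mem_cons]
    rcases ih (cond (natLt (key c) (key b)) c b) with h | h
    · rw [h]
      cases natLt (key c) (key b) <;> simp
    · exact .inr (.inr h)

omit [Enc α] in
theorem key_argminList_le (key : α → ℕ) (b : α) (l : List α) :
    ∀ a ∈ b :: l, key (argminList key b l) ≤ key a := by
  have h : key (argminList key b l) = minList (key b) (l.map key) := by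
    induction l generalizing b with
    | nil => rfl
    | cons c l ih =>
      have h3 : argminList key b (c :: l) =
        argminList key (cond (natLt (key c) (key b)) c b) l := rfl
      rw [h3, ih]
      cases h : natLt (key c) (key b) <;> simp [minList, h]
  intro a ha
  rw [h]
  rcases List.mem_cons.1 ha with rfl | ha
  · exact (minList_le _ _).1
  · exact (minList_le _ _).2 _ (List.mem_map_of_mem ha)

end GMEG

namespace GMEG
open Enc (enc)

/-! ### The algorithm -/

/-- The data of an instance, with the encoding of `Instance.encode`. -/
abbrev RawInstance : Type := ℕ × (List ℕ × List (List Val))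

/-- Vertex sets as lists of truth values. -/
abbrev Mask : Type := List Bool

namespace RawInstance

/-- The list of vertices. -/
def verts (J : RawInstance) : List ℕ := List.range J.2.1.length

/-- Entry of the matrix of an instance. -/
def entry (J : RawInstance) (u v : ℕ) : Val := (J.2.2.getD u []).getD v (.num 0)

/-- Adjacency. -/
def adj (J : RawInstance) (u v : ℕ) : Bool := (J.entry u v).truthy

/-- Membership in the set of edges to be monitored. -/
def target (J : RawInstance) (u v : ℕ) : Bool := (J.entry u v).snd.truthy

/-- Denominator of the weight of an edge; `1` if there is no edge. -/
def den (J : RawInstance) (u v : ℕ) : ℕ := cond (J.adj u v) (J.entry u v).fst.snd.toNat 1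

/-- A common denominator of the weights. -/
def commonDen (J : RawInstance) : ℕ :=
  (J.verts.map fun u => (J.verts.map fun v => J.den u v).prod).prod

/-- The scaled weight of an edge. -/
def wt (J : RawInstance) (u v : ℕ) : ℕ :=
  (J.entry u v).fst.fst.toNat * (J.commonDen / (J.entry u v).fst.snd.toNat)

/-- A number larger than the weight of any path. -/
def big (J : RawInstance) : ℕ := (J.verts.map fun u => (J.verts.map fun v => J.wt u v).sum).sum + 1

/-- Length of the arc from `u` to `v` in the complete digraph, where the edge `ab` is avoided. -/
def arc (J : RawInstance) (a b u v : ℕ) : ℕ :=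
  cond (J.adj u v && !((natEq u a && natEq v b) || (natEq u b && natEq v a))) (J.wt u v) J.big

/-- One round of the Bellman–Ford algorithm. -/
def relax (J : RawInstance) (a b : ℕ) (d : List ℕ) : List ℕ :=
  J.verts.map fun y => minList (d.getD y 0) (J.verts.map fun z => d.getD z 0 + J.arc a b z y)

/-- Initial distances. -/
def init (J : RawInstance) (x : ℕ) : List ℕ := J.verts.map fun y => cond (natEq x y) 0 J.big

/-- Distances from `x` to all vertices, where the edge `ab` is avoided. -/
def dist (J : RawInstance) (a b x : ℕ) : List ℕ :=
  J.verts.foldl (fun d _ => J.relax a b d) (J.init x)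

/-- Whether the pair `x, y` monitors the edge `uv`. -/
def mon (J : RawInstance) (x y u v : ℕ) : Bool :=
  !natEq x y && !natEq ((J.dist x x x).getD y 0) ((J.dist u v x).getD y 0)

/-- Whether the edge `uv` is monitored by some pair in `M`. -/
def covers (J : RawInstance) (M : Mask) (u v : ℕ) : Bool :=
  J.verts.any fun x => M.getD x false && J.verts.any fun y => M.getD y false && J.mon x y u v

/-- Number of ordered pairs that represent unmonitored edges. -/
def uncov (J : RawInstance) (M : Mask) : ℕ :=
  (J.verts.map fun u => (J.verts.filter fun v => J.target u v && !J.covers M u v).length).sum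

/-- `M ∪ {x, y}`. -/
def addPair (J : RawInstance) (M : Mask) (x y : ℕ) : Mask :=
  J.verts.map fun v => M.getD v false || (natEq v x || natEq v y)

/-- Add to `M` the pair of vertices that leaves the fewest edges unmonitored. -/
def greedyStep (J : RawInstance) (M : Mask) : Mask :=
  argminList J.uncov M (J.verts.map fun x => argminList J.uncov M (J.verts.map (J.addPair M x)))

/-- The complement of a set. -/
def compl (J : RawInstance) (X : Mask) : Mask := J.verts.map fun v => !X.getD v false

/-- The intersection of two sets. -/
def inter (J : RawInstance) (M M' : Mask) : Mask :=
  J.verts.map fun v => M.getD v false && M'.getD v false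

/-- The greedy solution that contains the complement of `X`. -/
def greedy (J : RawInstance) (X : Mask) : Mask :=
  J.verts.foldl (fun M _ => J.verts.foldl (fun M' _ => J.greedyStep M') M) (J.compl X)

/-- The list of elements of a set. -/
def members (J : RawInstance) (X : Mask) : List ℕ := J.verts.filter fun v => X.getD v false

/-- The data of an induced subgraph. -/
def inducedGraph (J : RawInstance) (X : Mask) : ℕ × List (List Bool) :=
  ((J.members X).length, (J.members X).map fun u => (J.members X).map fun v => J.adj u v)

/-- The set of vertices that corresponds to a set of vertices of an induced subgraph. -/
def lift (J : RawInstance) (X A : Mask) : Mask :=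
  J.verts.map fun v => (List.range (J.members X).length).any fun i =>
    A.getD i false && natEq ((J.members X).getD i 0) v

/-- The cost-one vertices. -/
def costly (J : RawInstance) : Mask := J.verts.map fun v => natLt 0 (J.2.1.getD v 0)

/-- The state after processing the last set on the stack. -/
def leaf (J : RawInstance) (x : List Mask × Mask) : List Mask × Mask :=
  (x.1.tail, J.inter x.2 (J.greedy (x.1.getD 0 [])))

/-- The state after replacing the last set on the stack by two parts of it. -/
def split (J : RawInstance) (x : List Mask × Mask) (s : Mask × (Mask × Mask)) :
    List Mask × Mask :=
  (J.lift (x.1.getD 0 []) s.2.1 :: J.lift (x.1.getD 0 []) s.2.2 :: x.1.tail, x.2)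

/-- Whether the greedy solution costs at most as much as the separator. -/
def greedyCheap (J : RawInstance) (X S : Mask) : Bool :=
  !natLt (S.filter fun b => b).length (J.members (J.inter X (J.greedy X))).length

/-- One step of the algorithm. -/
def workStep (n₀ : ℕ) (sep : ℕ × List (List Bool) → Mask × (Mask × Mask)) (J : RawInstance)
    (x : List Mask × Mask) : List Mask × Mask :=
  cond (isCons x.1)
    (cond (natLt (J.members (x.1.getD 0 [])).length n₀) (J.leaf x)
      (cond (J.greedyCheap (x.1.getD 0 []) (sep (J.inducedGraph (x.1.getD 0 []))).1) (J.leaf x)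
        (J.split x (sep (J.inducedGraph (x.1.getD 0 []))))))
    x

/-- The whole algorithm. -/
def solve (n₀ : ℕ) (sep : ℕ × List (List Bool) → Mask × (Mask × Mask)) (J : RawInstance) : Mask :=
  ((0 :: (J.verts ++ J.verts)).foldl (fun x _ => workStep n₀ sep J x)
    ([J.costly], J.verts.map fun _ => true)).2

end RawInstance

/-! ### Polynomial running time of the subroutines. -/

namespace PolyTime
open RawInstance

variable {δ : Type} [Enc δ] {J : δ → RawInstance} {a b x y u v : δ → ℕ} {M M' : δ → Mask}

@[fun_prop]
theorem verts (hJ : PolyTime J) : PolyTime fun d => verts (J d) := by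
  unfold RawInstance.verts
  fun_prop

@[fun_prop]
theorem entry (hJ : PolyTime J) (hu : PolyTime u) (hv : PolyTime v) :
    PolyTime fun d => entry (J d) (u d) (v d) := by
  unfold RawInstance.entry
  fun_prop

@[fun_prop]
theorem adj (hJ : PolyTime J) (hu : PolyTime u) (hv : PolyTime v) :
    PolyTime fun d => adj (J d) (u d) (v d) := by
  unfold RawInstance.adj
  fun_prop

@[fun_prop]
theorem target (hJ : PolyTime J) (hu : PolyTime u) (hv : PolyTime v) :
    PolyTime fun d => target (J d) (u d) (v d) := by
  unfold RawInstance.target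
  fun_prop

@[fun_prop]
theorem den (hJ : PolyTime J) (hu : PolyTime u) (hv : PolyTime v) :
    PolyTime fun d => den (J d) (u d) (v d) := by
  unfold RawInstance.den
  fun_prop

@[fun_prop]
theorem commonDen (hJ : PolyTime J) : PolyTime fun d => commonDen (J d) := by
  unfold RawInstance.commonDen
  fun_prop

@[fun_prop]
theorem wt (hJ : PolyTime J) (hu : PolyTime u) (hv : PolyTime v) :
    PolyTime fun d => wt (J d) (u d) (v d) := by
  unfold RawInstance.wt
  fun_prop

@[fun_prop]
theorem big (hJ : PolyTime J) : PolyTime fun d => big (J d) := by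
  unfold RawInstance.big
  fun_prop

@[fun_prop]
theorem arc (hJ : PolyTime J) (ha : PolyTime a) (hb : PolyTime b) (hu : PolyTime u)
    (hv : PolyTime v) : PolyTime fun d => arc (J d) (a d) (b d) (u d) (v d) := by
  unfold RawInstance.arc
  fun_prop

@[fun_prop]
theorem relax {l : δ → List ℕ} (hJ : PolyTime J) (ha : PolyTime a) (hb : PolyTime b)
    (hl : PolyTime l) : PolyTime fun d => relax (J d) (a d) (b d) (l d) := by
  unfold RawInstance.relax
  fun_prop

@[fun_prop]
theorem init (hJ : PolyTime J) (hx : PolyTime x) : PolyTime fun d => init (J d) (x d) := by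
  unfold RawInstance.init
  fun_prop

end PolyTime
end GMEG

namespace GMEG
open Enc (enc)

theorem RawInstance.getD_le {d : List ℕ} {B : ℕ} (h : ∀ a ∈ d, a ≤ B) (i : ℕ) : d.getD i 0 ≤ B := by
  rcases lt_or_ge i d.length with h1 | h1
  · rw [List.getD_eq_getElem _ _ h1]
    exact h _ (List.getElem_mem h1)
  · rw [List.getD_eq_default _ _ h1]
    exact Nat.zero_le _

theorem foldl_induction {α β : Type} {P : β → Prop} {f : β → α → β} {b : β} {l : List α} (hb : P b)
    (h : ∀ b a, P b → P (f b a)) : P (l.foldl f b) := by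
  induction l generalizing b with
  | nil => exact hb
  | cons a l ih => exact ih (h b a hb)

namespace PolyTime
open RawInstance

variable {δ : Type} [Enc δ] {J : δ → RawInstance} {a b x y u v : δ → ℕ} {M M' X A : δ → Mask}

@[fun_prop]
theorem dist (hJ : PolyTime J) (ha : PolyTime a) (hb : PolyTime b) (hx : PolyTime x) :
    PolyTime fun d => dist (J d) (a d) (b d) (x d) := by
  unfold RawInstance.dist
  refine foldl (f := fun d l _ => RawInstance.relax (J d) (a d) (b d) l)
    (g := fun d => (J d).verts.length * (esize (J d).big + 1) + 1) (by fun_prop) (by fun_prop)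
    (by fun_prop) ?_ fun d l₁ l₂ _ => ?_
  · refine PolyBdd.add (.mul ?_ (.add ?_ (.const 1))) (.const 1)
    · have h : PolyTime fun d => RawInstance.verts (J d) := by fun_prop
      exact h.polyBdd.mono fun d _ => (length_lt_esize _).le
    · have h : PolyTime fun d => RawInstance.big (J d) := by fun_prop
      exact h.polyBdd
  -- Initial entries are `0` or `big`, and `relax` never raises an entry, so `big` bounds all
  -- numbers that occur.
  · have h : ((l₁.foldl (fun l _ => (J d).relax (a d) (b d) l) ((J d).init (x d))).length =
        (J d).verts.length) ∧ ∀ c ∈ l₁.foldl (fun l _ => (J d).relax (a d) (b d) l)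
          ((J d).init (x d)), c ≤ (J d).big := by
      refine foldl_induction (P := fun l : List ℕ => l.length = (J d).verts.length ∧ ∀ c ∈ l, c ≤ (J d).big)
        ⟨by simp [RawInstance.init], fun c hc => ?_⟩
        fun l _ hl => ⟨by simp [RawInstance.relax], fun c hc => ?_⟩
      · simp only [RawInstance.init, List.mem_map] at hc
        obtain ⟨y, -, rfl⟩ := hc
        cases GMEG.natEq (x d) y <;> simp
      · simp only [RawInstance.relax, List.mem_map] at hc
        obtain ⟨y, -, rfl⟩ := hc
        exact (minList_le _ _).1.trans (getD_le hl.2 _)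
    rw [← h.1]
    refine esize_list_le fun c hc => ?_
    have := Nat.size_le_size (h.2 c hc)
    simp only [esize_nat]
    omega

@[fun_prop]
theorem mon (hJ : PolyTime J) (hx : PolyTime x) (hy : PolyTime y) (hu : PolyTime u)
    (hv : PolyTime v) : PolyTime fun d => mon (J d) (x d) (y d) (u d) (v d) := by
  unfold RawInstance.mon
  fun_prop

@[fun_prop]
theorem covers (hJ : PolyTime J) (hM : PolyTime M) (hu : PolyTime u) (hv : PolyTime v) :
    PolyTime fun d => covers (J d) (M d) (u d) (v d) := by
  unfold RawInstance.covers
  fun_prop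

@[fun_prop]
theorem uncov (hJ : PolyTime J) (hM : PolyTime M) : PolyTime fun d => uncov (J d) (M d) := by
  unfold RawInstance.uncov
  fun_prop

@[fun_prop]
theorem addPair (hJ : PolyTime J) (hM : PolyTime M) (hx : PolyTime x) (hy : PolyTime y) :
    PolyTime fun d => addPair (J d) (M d) (x d) (y d) := by
  unfold RawInstance.addPair
  fun_prop

@[fun_prop]
theorem greedyStep (hJ : PolyTime J) (hM : PolyTime M) :
    PolyTime fun d => greedyStep (J d) (M d) := by
  unfold RawInstance.greedyStep
  fun_prop

@[fun_prop]
theorem compl (hJ : PolyTime J) (hM : PolyTime M) : PolyTime fun d => compl (J d) (M d) := by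
  unfold RawInstance.compl
  fun_prop

@[fun_prop]
theorem inter (hJ : PolyTime J) (hM : PolyTime M) (hM' : PolyTime M') :
    PolyTime fun d => inter (J d) (M d) (M' d) := by
  unfold RawInstance.inter
  fun_prop

theorem esize_mask_le {M : Mask} {n : ℕ} (h : M.length ≤ n) : esize M ≤ n * 3 + 1 := by
  have := esize_list_le (l := M) (B := 2) fun b _ => esize_bool_le b
  omega

theorem greedyStep_length {J : RawInstance} {M : Mask} :
    J.greedyStep M = M ∨ (J.greedyStep M).length = J.verts.length := by
  rcases argminList_mem J.uncov M
    (J.verts.map fun x => GMEG.argminList J.uncov M (J.verts.map (J.addPair M x))) with h | h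
  · exact .inl h
  · obtain ⟨x, -, h⟩ := List.mem_map.1 h
    rcases argminList_mem J.uncov M (J.verts.map (J.addPair M x)) with h' | h'
    · exact .inl (h.symm.trans h')
    · obtain ⟨y, -, h'⟩ := List.mem_map.1 h'
      right
      unfold RawInstance.greedyStep
      rw [← h, ← h']
      simp [RawInstance.addPair]

theorem esize_greedyStep_le {J : RawInstance} {M : Mask} {B : ℕ} (h : esize M ≤ B)
    (hB : J.verts.length * 3 + 1 ≤ B) : esize (J.greedyStep M) ≤ B := by
  rcases greedyStep_length (J := J) (M := M) with h1 | h1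
  · rwa [h1]
  · exact (esize_mask_le h1.le).trans hB

theorem polyBdd_verts (hJ : PolyTime J) :
    PolyBdd Set.univ fun d => (J d).verts.length * 3 + 1 := by
  have h : PolyTime fun d => RawInstance.verts (J d) := by fun_prop
  exact ((h.polyBdd.mono fun d _ => (length_lt_esize _).le).mul (.const 3)).add (.const 1)

@[fun_prop]
theorem greedyRound (hJ : PolyTime J) (hM : PolyTime M) :
    PolyTime fun d => (J d).verts.foldl (fun M' _ => (J d).greedyStep M') (M d) :=
  foldl (f := fun d M' _ => (J d).greedyStep M')
    (g := fun d => esize (M d) + ((J d).verts.length * 3 + 1)) (by fun_prop) (by fun_prop)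
    (by fun_prop) (hM.polyBdd.add (polyBdd_verts hJ)) fun d _ _ _ =>
      foldl_induction (P := fun M' => esize M' ≤ _) (by omega)
        fun M' _ h => esize_greedyStep_le h (by omega)

@[fun_prop]
theorem greedy (hJ : PolyTime J) (hX : PolyTime X) : PolyTime fun d => greedy (J d) (X d) := by
  refine foldl (f := fun d M _ => (J d).verts.foldl (fun M' _ => (J d).greedyStep M') M)
    (g := fun d => (J d).verts.length * 3 + 1) (by fun_prop) (by fun_prop)
    (greedyRound (J := fun y : δ × (Mask × ℕ) => J y.1) (by fun_prop) (by fun_prop))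
    (polyBdd_verts hJ) fun d _ _ _ =>
      foldl_induction (P := fun M' => esize M' ≤ _) ?_ fun M' _ h =>
        foldl_induction (P := fun M' => esize M' ≤ _) h
          fun M' _ h => esize_greedyStep_le h le_rfl
  exact esize_mask_le (by simp [RawInstance.compl])

@[fun_prop]
theorem members (hJ : PolyTime J) (hX : PolyTime X) : PolyTime fun d => members (J d) (X d) := by
  unfold RawInstance.members
  fun_prop

@[fun_prop]
theorem inducedGraph (hJ : PolyTime J) (hX : PolyTime X) :
    PolyTime fun d => inducedGraph (J d) (X d) := by
  unfold RawInstance.inducedGraph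
  fun_prop

@[fun_prop]
theorem lift (hJ : PolyTime J) (hX : PolyTime X) (hA : PolyTime A) :
    PolyTime fun d => lift (J d) (X d) (A d) := by
  unfold RawInstance.lift
  fun_prop

@[fun_prop]
theorem costly (hJ : PolyTime J) : PolyTime fun d => costly (J d) := by
  unfold RawInstance.costly
  fun_prop

@[fun_prop]
theorem leaf {x : δ → List Mask × Mask} (hJ : PolyTime J) (hx : PolyTime x) :
    PolyTime fun d => leaf (J d) (x d) := by
  unfold RawInstance.leaf
  fun_prop

@[fun_prop]
theorem split {x : δ → List Mask × Mask} {s : δ → Mask × (Mask × Mask)} (hJ : PolyTime J)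
    (hx : PolyTime x) (hs : PolyTime s) : PolyTime fun d => split (J d) (x d) (s d) := by
  unfold RawInstance.split
  fun_prop

@[fun_prop]
theorem greedyCheap (hJ : PolyTime J) (hX : PolyTime X) (hM : PolyTime M) :
    PolyTime fun d => greedyCheap (J d) (X d) (M d) := by
  unfold RawInstance.greedyCheap
  fun_prop

end PolyTime

/-! ### Polynomial running time of the whole algorithm. -/

namespace RawInstance

variable {n₀ : ℕ} {sep : ℕ × List (List Bool) → Mask × (Mask × Mask)} {s : Set RawInstance}

/-- Only the chosen branch of a `cond` is executed, so `sep` is called only on induced subgraphs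
with at least `n₀` vertices, where its running time is controlled. -/
theorem polyTimeOn_workStep (h : PolyTimeOn {g | ∃ J ∈ s, ∃ X, g = J.inducedGraph X ∧
      n₀ ≤ (J.members X).length} sep) :
    PolyTimeOn {y : RawInstance × (List Mask × Mask) | y.1 ∈ s}
      fun y => workStep n₀ sep y.1 y.2 := by
  have h1 : PolyTimeOn {y : RawInstance × (List Mask × Mask) | (y.1 ∈ s ∧ isCons y.2.1 = true) ∧
      natLt (y.1.members (y.2.1.getD 0 [])).length n₀ = false}
      fun y => sep (y.1.inducedGraph (y.2.1.getD 0 [])) := by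
    refine h.comp (f := fun y : RawInstance × (List Mask × Mask) =>
      y.1.inducedGraph (y.2.1.getD 0 [])) (PolyTime.on (by fun_prop)) ?_
    rintro ⟨J, x⟩ ⟨⟨h1, h2⟩, h3⟩
    rw [← Bool.not_eq_true, natLt_iff, not_lt] at h3
    exact ⟨J, h1, _, rfl, h3⟩
  have h2 := PolyTime.id.on.prodMk h1
  have h3 : PolyTime fun z : (RawInstance × (List Mask × Mask)) × (Mask × (Mask × Mask)) =>
      z.1.1.greedyCheap (z.1.2.1.getD 0 []) z.2.1 := by fun_prop
  have h4 : PolyTime fun z : (RawInstance × (List Mask × Mask)) × (Mask × (Mask × Mask)) =>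
      z.1.1.split z.1.2 z.2 := by fun_prop
  have h5 := PolyTimeOn.comp h3 h2 fun _ _ => trivial
  have h6 := PolyTimeOn.comp h4 h2 fun _ _ => trivial
  have h7 : PolyTime fun y : RawInstance × (List Mask × Mask) => y.1.leaf y.2 := by fun_prop
  have h8 := PolyTimeOn.cond h5 h7.on (h6.mono fun _ hy => hy.1)
  have h9 : PolyTime fun y : RawInstance × (List Mask × Mask) =>
    natLt (y.1.members (y.2.1.getD 0 [])).length n₀ := by fun_prop
  have h10 := PolyTimeOn.cond h9.on h7.on h8
  have h11 : PolyTime fun y : RawInstance × (List Mask × Mask) => isCons y.2.1 := by fun_prop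
  exact PolyTimeOn.cond h11.on h10 (PolyTime.on (by fun_prop))

/-- Serves to keep the state polynomially long during the fold in `solve`: after j steps the stack
holds at most j + 1 masks, all of full length. -/
theorem workStep_bounds (J : RawInstance) (x : List Mask × Mask)
    (h : (∀ X ∈ x.1, X.length = J.verts.length) ∧ x.2.length = J.verts.length) :
    ((∀ X ∈ (workStep n₀ sep J x).1, X.length = J.verts.length) ∧
      (workStep n₀ sep J x).2.length = J.verts.length) ∧
      (workStep n₀ sep J x).1.length ≤ x.1.length + 1 := by
  have h1 : ((∀ X ∈ (J.leaf x).1, X.length = J.verts.length) ∧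
      (J.leaf x).2.length = J.verts.length) ∧ (J.leaf x).1.length ≤ x.1.length + 1 :=
    ⟨⟨fun X hX => h.1 X (List.mem_of_mem_tail hX), by simp [leaf, inter]⟩, by simp [leaf]; omega⟩
  have h2 (t) : isCons x.1 = true → ((∀ X ∈ (J.split x t).1, X.length = J.verts.length) ∧
      (J.split x t).2.length = J.verts.length) ∧ (J.split x t).1.length ≤ x.1.length + 1 := by
    intro h3
    refine ⟨⟨fun X hX => ?_, h.2⟩, ?_⟩
    · simp only [split, List.mem_cons] at hX
      rcases hX with rfl | rfl | hX
      · simp [lift]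
      · simp [lift]
      · exact h.1 X (List.mem_of_mem_tail hX)
    · rcases x with ⟨_ | ⟨X, l⟩, M⟩
      · cases h3
      · simp [split]
  unfold workStep
  cases h3 : isCons x.1
  · exact ⟨h, Nat.le_succ _⟩
  · rw [cond_true]
    cases natLt (J.members (x.1.getD 0 [])).length n₀
    · rw [cond_false]
      cases J.greedyCheap (x.1.getD 0 []) (sep (J.inducedGraph (x.1.getD 0 []))).1
      · exact h2 _ h3
      · exact h1
    · exact h1

theorem polyTimeOn_solve (h : PolyTimeOn {g | ∃ J ∈ s, ∃ X, g = J.inducedGraph X ∧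
      n₀ ≤ (J.members X).length} sep) : PolyTimeOn s (solve n₀ sep) := by
  have h0 : PolyTime fun J : RawInstance => 0 :: (J.verts ++ J.verts) := by fun_prop
  have hb := (PolyTime.polyBdd_verts (J := fun J : RawInstance => J) (by fun_prop)).mono
    fun J _ => (le_rfl : J.verts.length * 3 + 1 ≤ _)
  refine (PolyTime.on (s := Set.univ) (f := fun z : List Mask × Mask => z.2) (by fun_prop)).comp
    (PolyTimeOn.foldl (f := fun J x _ => workStep n₀ sep J x)
      (g := fun J => ((esize (0 :: (J.verts ++ J.verts)) + 1) *
        (J.verts.length * 3 + 1 + 1) + 1) + (J.verts.length * 3 + 1) + 1) h0.on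
      (PolyTime.on (by fun_prop)) ?_ ?_ ?_) fun _ _ => trivial
  · exact (polyTimeOn_workStep h).comp (f := fun y : RawInstance × ((List Mask × Mask) × ℕ) =>
      (y.1, y.2.1)) (PolyTime.on (by fun_prop)) fun y hy => hy.1
  · exact PolyBdd.on (((((h0.polyBdd.add (.const 1)).mul (hb.add (.const 1))).add
      (.const 1)).add hb).add (.const 1))
  · intro J _ l₁ l₂ hl
    have key : ((∀ X ∈ (l₁.foldl (fun x _ => workStep n₀ sep J x)
        ([J.costly], J.verts.map fun _ => true)).1, X.length = J.verts.length) ∧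
        (l₁.foldl (fun x _ => workStep n₀ sep J x)
        ([J.costly], J.verts.map fun _ => true)).2.length = J.verts.length) ∧
        (l₁.foldl (fun x _ => workStep n₀ sep J x)
        ([J.costly], J.verts.map fun _ => true)).1.length ≤ l₁.length + 1 := by
      clear hl
      induction l₁ using List.reverseRecOn with
      | nil => simp [costly]
      | append_singleton l a ih =>
        rw [List.foldl_append, List.length_append]
        have := workStep_bounds (n₀ := n₀) (sep := sep) J _ ih.1
        have h1 := this.2
        have h2 := ih.2
        refine ⟨this.1, ?_⟩
        simp only [List.foldl_cons, List.foldl_nil, List.length_singleton]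
        omega
    obtain ⟨⟨h1, h2⟩, h3⟩ := key
    rw [esize_prod]
    have h4 := esize_list_le (B := J.verts.length * 3 + 1)
      fun X hX => PolyTime.esize_mask_le (h1 X hX).le
    have h5 := PolyTime.esize_mask_le h2.le
    have h6 : l₁.length ≤ esize (0 :: (J.verts ++ J.verts)) := by
      rw [hl]
      have := length_lt_esize (l₁ ++ l₂)
      rw [List.length_append] at this
      omega
    have h7 := Nat.mul_le_mul_right (J.verts.length * 3 + 1 + 1)
      (h3.trans (Nat.add_le_add_right h6 1))
    omega

end RawInstance
end GMEG

namespace GMEG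

/-! ### Monitoring and shortest walks -/

section Monitoring

variable {V : Type} {G : SimpleGraph V} {w : Sym2 V → ℚ≥0} {u v x y s : V} {e : Sym2 V}

open SimpleGraph

theorem walkWeight_append (p : G.Walk x s) (q : G.Walk s y) :
    walkWeight w (p.append q) = walkWeight w p + walkWeight w q := by
  simp [walkWeight, Walk.edges_append]

theorem walkWeight_bypass_le [DecidableEq V] (p : G.Walk x y) :
    walkWeight w p.bypass ≤ walkWeight w p :=
  ((Walk.edges_bypass_sublist_edges p).map w).sum_le_sum fun _ _ => zero_le

/-- A walk of minimum weight among all walks with the same endpoints. -/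
def IsMinWalk (w : Sym2 V → ℚ≥0) (p : G.Walk x y) : Prop :=
  ∀ q : G.Walk x y, walkWeight w p ≤ walkWeight w q

/-- Weights are non-negative, so `bypass` does not increase the weight and minima over paths and
over walks agree. -/
theorem isShortestPath_iff {p : G.Walk x y} : IsShortestPath w p ↔ p.IsPath ∧ IsMinWalk w p := by
  classical
  exact ⟨fun h => ⟨h.1, fun q => (h.2 _ q.bypass_isPath).trans (walkWeight_bypass_le q)⟩,
    fun h => ⟨h.1, fun q _ => h.2 q⟩⟩

theorem IsMinWalk.isShortestPath_bypass [DecidableEq V] {p : G.Walk x y} (hp : IsMinWalk w p) :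
    IsShortestPath w p.bypass :=
  isShortestPath_iff.2 ⟨p.bypass_isPath, fun q => (walkWeight_bypass_le p).trans (hp q)⟩

/-- Walks, unlike paths, can be concatenated freely; all cutting and pasting below uses this form.
-/
theorem monitors_iff : Monitors G w x y e ↔
    x ≠ y ∧ ∀ p : G.Walk x y, IsMinWalk w p → e ∈ p.edges := by
  classical
  exact ⟨fun h => ⟨h.1, fun p hp =>
      p.edges_bypass_subset_edges (h.2 _ hp.isShortestPath_bypass)⟩,
    fun h => ⟨h.1, fun p hp => h.2 p (isShortestPath_iff.1 hp).2⟩⟩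

theorem exists_isShortestPath [Finite V] (h : G.Reachable x y) :
    ∃ p : G.Walk x y, IsShortestPath w p := by
  classical
  have := Fintype.ofFinite V
  have hfin : {p : G.Walk x y | p.IsPath}.Finite := by
    refine Set.Finite.subset ((Set.finite_lt_nat (Fintype.card V)).biUnion
      (t := fun n => {p : G.Walk x y | p.length = n}) fun n _ => ?_) fun p hp => ?_
    · exact Set.toFinite _
    · simp only [Set.mem_iUnion]
      exact ⟨_, hp.length_lt, rfl⟩
  obtain ⟨p⟩ := h
  obtain ⟨q, hq, hmin⟩ := Set.exists_min_image _ (fun p => walkWeight w p) hfin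
    ⟨p.bypass, p.bypass_isPath⟩
  exact ⟨q, hq, hmin⟩

theorem IsMinWalk.of_append_right {p : G.Walk x s} {q : G.Walk s y}
    (h : IsMinWalk w (p.append q)) : IsMinWalk w q := fun q' => by
  have := h (p.append q')
  rw [walkWeight_append, walkWeight_append] at this
  exact le_of_add_le_add_left this

theorem IsMinWalk.of_append_left {p : G.Walk x s} {q : G.Walk s y}
    (h : IsMinWalk w (p.append q)) : IsMinWalk w p := fun p' => by
  have := h (p'.append q)
  rw [walkWeight_append, walkWeight_append] at this
  exact le_of_add_le_add_right this

theorem IsMinWalk.append {p p' : G.Walk x s} {q q' : G.Walk s y}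
    (h : IsMinWalk w (p.append q)) (hp : IsMinWalk w p') (hq : IsMinWalk w q') :
    IsMinWalk w (p'.append q') := fun r => by
  refine le_trans ?_ (h r)
  rw [walkWeight_append, walkWeight_append]
  exact add_le_add (hp p) (hq q)

theorem isMinWalk_nil : IsMinWalk w (Walk.nil : G.Walk x x) := fun q => by
  simp [walkWeight]

/-- Any minimum walk from `x` to `s` followed by `q` is minimum, so it contains `e`, and `q` does
not. For `x = s` the empty walk in front of `q` gives the contradiction. -/
theorem Monitors.left (hm : Monitors G w x y e) {p : G.Walk x s} {q : G.Walk s y}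
    (h : IsMinWalk w (p.append q)) (he : e ∉ q.edges) : Monitors G w x s e := by
  rw [monitors_iff] at hm ⊢
  constructor
  · rintro rfl
    have := hm.2 _ (h.append isMinWalk_nil h.of_append_right)
    exact he this
  · intro p' hp'
    have := hm.2 _ (h.append hp' h.of_append_right)
    rw [Walk.edges_append, List.mem_append] at this
    exact this.resolve_right he

theorem Monitors.right (hm : Monitors G w x y e) {p : G.Walk x s} {q : G.Walk s y}
    (h : IsMinWalk w (p.append q)) (he : e ∉ p.edges) : Monitors G w s y e := by
  rw [monitors_iff] at hm ⊢
  constructor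
  · rintro rfl
    have := hm.2 _ (h.append h.of_append_left isMinWalk_nil)
    rw [Walk.append_nil] at this
    exact he this
  · intro q' hq'
    have := hm.2 _ (h.append h.of_append_left hq')
    rw [Walk.edges_append, List.mem_append] at this
    exact this.resolve_left he

theorem exists_append_of_mem_edges {p : G.Walk x y} (h : e ∈ p.edges) :
    ∃ (a b : V) (hab : G.Adj a b) (p₁ : G.Walk x a) (p₂ : G.Walk b y),
      p = p₁.append (.cons hab p₂) ∧ s(a, b) = e := by
  induction p with
  | nil => simp at h
  | @cons x z y hxz p ih =>
    rw [Walk.edges_cons, List.mem_cons] at h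
    rcases h with rfl | h
    · exact ⟨x, z, hxz, .nil, p, rfl, rfl⟩
    · obtain ⟨a, b, hab, p₁, p₂, rfl, he⟩ := ih h
      exact ⟨a, b, hab, .cons hxz p₁, p₂, rfl, he⟩

/-- A walk that starts in `M` and ends in `A` or in `C` meets `C`, if `C` contains the outer
boundary of `A` and `M ∩ A`, and `M` contains the complement of `A`. -/
theorem exists_append_of_boundary {A M C : Set V} (hM : Aᶜ ⊆ M) (hC : M ∩ A ⊆ C)
    (hb : ∀ a ∈ A, ∀ b, G.Adj a b → b ∉ A → b ∈ C) (p : G.Walk x u) (hx : x ∈ M)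
    (hu : u ∈ A ∨ u ∈ C) : ∃ s ∈ C, ∃ (p₁ : G.Walk x s) (p₂ : G.Walk s u), p = p₁.append p₂ := by
  induction p with
  | nil => exact ⟨_, hu.elim (fun h => hC ⟨hx, h⟩) fun h => h, .nil, .nil, rfl⟩
  | @cons x z u hxz p ih =>
    by_cases hxC : x ∈ C
    · exact ⟨x, hxC, .nil, .cons hxz p, rfl⟩
    -- Outside `C`, the vertex `x` is neither in `A` nor on its outer boundary. Hence the next
    -- vertex is outside `A`, therefore in `M`, and the induction continues.
    · have hxA : x ∉ A := fun h => hxC (hC ⟨hx, h⟩)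
      have hzA : z ∉ A := fun h => hxC (hb z h x hxz.symm hxA)
      obtain ⟨s, hs, p₁, p₂, rfl⟩ := ih (hM hzA) hu
      exact ⟨s, hs, .cons hxz p₁, p₂, rfl⟩

/-- Cut a shortest path at a vertex of `C` on either side of `e`. A path uses `e` only once, so the
two outer pieces avoid it and can be discarded by `Monitors.right` and `Monitors.left`. -/
theorem Monitors.of_boundary [Finite V] (hG : G.Connected) {A M C : Set V} (hM : Aᶜ ⊆ M)
    (hC : M ∩ A ⊆ C) (hb : ∀ a ∈ A, ∀ b, G.Adj a b → b ∉ A → b ∈ C)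
    (hx : x ∈ M) (hy : y ∈ M) (he : ∀ z ∈ e, z ∈ A ∨ z ∈ C) (hm : Monitors G w x y e) :
    ∃ x' ∈ C, ∃ y' ∈ C, Monitors G w x' y' e := by
  obtain ⟨p, hp⟩ := exists_isShortestPath (w := w) (hG x y)
  obtain ⟨a, b, hab, p₁, p₂, rfl, rfl⟩ := exists_append_of_mem_edges (hm.2 p hp)
  obtain ⟨x', hx', q₁, q₂, rfl⟩ := exists_append_of_boundary hM hC hb p₁ hx (he a (by simp))
  obtain ⟨y', hy', r₁, r₂, hr⟩ :=
    exists_append_of_boundary hM hC hb p₂.reverse hy (he b (by simp))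
  have hr' : p₂ = r₂.reverse.append r₁.reverse := by
    rw [← Walk.reverse_append, ← hr, Walk.reverse_reverse]
  subst hr'
  refine ⟨x', hx', y', hy', ?_⟩
  obtain ⟨h1, h2⟩ := isShortestPath_iff.1 hp
  have h3 := h1.isTrail.edges_nodup
  simp only [Walk.edges_append, Walk.edges_cons, List.nodup_append, List.nodup_cons,
    List.mem_append] at h3
  have h4 : s(a, b) ∉ q₁.edges := fun h =>
    h3.2.2 _ (.inl h) _ List.mem_cons_self rfl
  rw [← Walk.append_assoc] at h2
  have h5 := hm.right h2 h4
  have h6 := h2.of_append_right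
  rw [← Walk.cons_append, Walk.append_assoc] at h6
  exact h5.left h6 fun h => h3.2.1.1 (.inr h)

end Monitoring

/-! ### Combining solutions across a separator. -/

theorem Instance.IsSolution.mono {n : ℕ} {I : Instance n} {M M' : Finset (Fin n)}
    (hM : I.IsSolution M) (h : M ⊆ M') : I.IsSolution M' := fun e he =>
  let ⟨x, hx, y, hy, hm⟩ := hM e he
  ⟨x, h hx, y, h hy, hm⟩

/-- Solutions for two parts of the graph without edges between them can be combined. -/
theorem Instance.IsSolution.inter {n : ℕ} {I : Instance n} (hI : I.graph.Connected)
    {A B M M' : Finset (Fin n)} (hAB : Disjoint A B)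
    (hadj : ∀ a ∈ A, ∀ b ∈ B, ¬I.graph.Adj a b) (hA : Aᶜ ⊆ M) (hB : Bᶜ ⊆ M')
    (hM : I.IsSolution M) (hM' : I.IsSolution M') : I.IsSolution (M ∩ M') := by
  -- Edges that meet `A`, or neither part, are handled with `M`; those that meet `B` follow by
  -- symmetry. Here `C = M ∩ M'` contains the outer boundary of `A`, which avoids `B` since no edge
  -- joins the parts, and it contains `M ∩ A` since `A ⊆ Bᶜ ⊆ M'`.
  have key : ∀ {A B M M' : Finset (Fin n)}, Disjoint A B →
      (∀ a ∈ A, ∀ b ∈ B, ¬I.graph.Adj a b) → Aᶜ ⊆ M → Bᶜ ⊆ M' → I.IsSolution M →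
      ∀ e ∈ I.target, ((∃ a ∈ e, a ∈ A) ∨ ∀ a ∈ e, a ∉ A ∧ a ∉ B) →
      ∃ x ∈ M ∩ M', ∃ y ∈ M ∩ M', Monitors I.graph I.weight x y e := by
    intro A B M M' hAB hadj hA hB hM e he h
    obtain ⟨x, hx, y, hy, hm⟩ := hM e he
    have hb : ∀ a ∈ (A : Set (Fin n)), ∀ b, I.graph.Adj a b → b ∉ (A : Set (Fin n)) →
        b ∈ ((M ∩ M' : Finset (Fin n)) : Set (Fin n)) := by
      intro a ha b hab hbA
      simp only [Finset.mem_coe, Finset.mem_inter]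
      exact ⟨hA (Finset.mem_compl.2 hbA),
        hB (Finset.mem_compl.2 fun hbB => hadj a ha b hbB hab)⟩
    have := hm.of_boundary hI (A := A) (M := M) (C := ((M ∩ M' : Finset (Fin n)) : Set (Fin n)))
      (fun z hz => hA (Finset.mem_compl.2 hz)) (fun z hz => by
        simp only [Finset.mem_coe, Finset.mem_inter]
        exact ⟨hz.1, hB (Finset.mem_compl.2 (Finset.disjoint_left.1 hAB hz.2))⟩) hb hx hy ?_
    · simpa only [Finset.mem_coe] using this
    · rcases h with ⟨a, hae, ha⟩ | h
      · intro z hz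
        by_cases hzA : z ∈ A
        · exact .inl hzA
        · refine .inr (hb a ha z ?_ hzA)
          have haz : a ≠ z := fun h => hzA (h ▸ ha)
          have := (Sym2.mem_and_mem_iff haz).1 ⟨hae, hz⟩
          rw [← SimpleGraph.mem_edgeSet, ← this]
          exact I.target_subset e he
      · intro z hz
        right
        simp only [Finset.mem_coe, Finset.mem_inter]
        exact ⟨hA (Finset.mem_compl.2 (h z hz).1), hB (Finset.mem_compl.2 (h z hz).2)⟩
  intro e he
  by_cases h1 : ∃ a ∈ e, a ∈ A
  · exact key hAB hadj hA hB hM e he (.inl h1)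
  by_cases h2 : ∃ a ∈ e, a ∈ B
  · rw [Finset.inter_comm]
    exact key hAB.symm (fun b hb a ha h => hadj a ha b hb h.symm) hB hA hM' e he (.inl h2)
  · push Not at h1 h2
    exact key hAB hadj hA hB hM e he (.inr fun a ha => ⟨h1 a ha, h2 a ha⟩)

end GMEG

namespace GMEG
open Enc (enc)

/-! ### Correctness of the distance computation -/

theorem enc_ofFn {α : Type} [Enc α] {n : ℕ} (f : Fin n → α) :
    enc (List.ofFn f) = .ofList (List.ofFn fun i => enc (f i)) := by
  show Val.ofList ((List.ofFn f).map enc) = _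
  rw [List.map_ofFn]
  rfl

theorem getD_ofFn {α : Type} {n : ℕ} (f : Fin n → α) (i : Fin n) (a : α) :
    (List.ofFn f).getD i a = f i := by
  simp [List.getD_eq_getElem?_getD]

theorem getD_map_range {α : Type} {n : ℕ} (f : ℕ → α) (i : Fin n) (a : α) :
    ((List.range n).map f).getD i a = f i := by
  simp [List.getD_eq_getElem?_getD]

theorem sum_map_range (n : ℕ) (f : ℕ → ℕ) : ((List.range n).map f).sum = ∑ i : Fin n, f i := by
  rw [← Finset.sum_range, ← List.sum_toFinset _ List.nodup_range, List.toFinset_range]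

namespace Instance

variable {n : ℕ} (I : Instance n)

open Classical in
/-- The data of an instance. -/
noncomputable def raw : RawInstance :=
  (n, (List.ofFn I.cost, List.ofFn fun u : Fin n => List.ofFn fun v : Fin n =>
    if I.graph.Adj u v then
      .pair (.pair (.num (I.weight s(u, v)).num) (.num (I.weight s(u, v)).den))
        (.num (if s(u, v) ∈ I.target then 1 else 0))
    else .num 0))

theorem enc_raw : enc I.raw = I.encode := by
  show Val.pair (.num n) (.pair (enc (List.ofFn I.cost)) (enc (List.ofFn _))) = _
  rw [enc_ofFn, enc_ofFn]
  simp only [enc_ofFn]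
  rfl

@[simp] theorem verts_raw : I.raw.verts = List.range n := by
  simp [RawInstance.verts, raw]

open Classical in
theorem entry_raw (u v : Fin n) : I.raw.entry u v = if I.graph.Adj u v then
    .pair (.pair (.num (I.weight s(u, v)).num) (.num (I.weight s(u, v)).den))
      (.num (if s(u, v) ∈ I.target then 1 else 0)) else .num 0 := by
  simp only [RawInstance.entry, raw, getD_ofFn]

theorem adj_raw (u v : Fin n) : I.raw.adj u v = true ↔ I.graph.Adj u v := by
  unfold RawInstance.adj
  rw [entry_raw]
  split_ifs with h <;> simp [h, Val.truthy]

theorem target_raw (u v : Fin n) : I.raw.target u v = true ↔ s(u, v) ∈ I.target := by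
  unfold RawInstance.target
  rw [entry_raw]
  by_cases h : I.graph.Adj u v
  · by_cases h' : s(u, v) ∈ I.target <;> simp [h, h', Val.snd, Val.truthy]
  · have : s(u, v) ∉ I.target := fun h' => h (I.target_subset _ h')
    simp [h, this, Val.snd, Val.truthy]

/-- The default `1` at non-edges matters: the matrix entry there would give `0` and annihilate the
common denominator. -/
theorem den_raw (u v : Fin n) : 0 < I.raw.den u v := by
  unfold RawInstance.den
  cases h : I.raw.adj u v
  · simp
  · rw [adj_raw] at h
    rw [cond_true, entry_raw, if_pos h]
    exact NNRat.den_pos _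

theorem commonDen_raw_pos : 0 < I.raw.commonDen := by
  have key : ∀ f : ℕ → ℕ, (∀ i : Fin n, 0 < f i) → 0 < ((List.range n).map f).prod := fun f hf =>
    List.prod_pos fun a ha => by
      obtain ⟨i, hi, rfl⟩ := List.mem_map.1 ha
      exact hf ⟨i, List.mem_range.1 hi⟩
  unfold RawInstance.commonDen
  rw [verts_raw]
  exact key _ fun u => key _ fun v => I.den_raw u v

theorem den_dvd_commonDen (u v : Fin n) : I.raw.den u v ∣ I.raw.commonDen := by
  unfold RawInstance.commonDen
  rw [verts_raw]
  exact (List.dvd_prod (List.mem_map_of_mem (f := fun v => I.raw.den u v)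
    (List.mem_range.2 v.2))).trans (List.dvd_prod (List.mem_map_of_mem
      (f := fun u => ((List.range n).map fun v => I.raw.den u v).prod) (List.mem_range.2 u.2)))

/-- The rounded-down division in `wt` is exact, since each denominator divides `commonDen`. -/
theorem wt_raw {u v : Fin n} (h : I.graph.Adj u v) :
    (I.raw.wt u v : ℚ≥0) = I.weight s(u, v) * I.raw.commonDen := by
  have h1 : I.raw.den u v = (I.weight s(u, v)).den := by
    unfold RawInstance.den
    rw [(I.adj_raw u v).2 h, cond_true, entry_raw, if_pos h]
    rfl
  have h2 : I.raw.wt u v =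
      (I.weight s(u, v)).num * (I.raw.commonDen / (I.weight s(u, v)).den) := by
    unfold RawInstance.wt
    rw [entry_raw, if_pos h]
    rfl
  obtain ⟨k, hk⟩ := I.den_dvd_commonDen u v
  rw [h1] at hk
  have h3 := NNRat.den_pos (I.weight s(u, v))
  have h4 : ((I.weight s(u, v)).den : ℚ≥0) ≠ 0 := by exact_mod_cast h3.ne'
  rw [h2, hk, Nat.mul_div_cancel_left _ h3]
  have h5 : I.weight s(u, v) = (I.weight s(u, v)).num / (I.weight s(u, v)).den :=
    (NNRat.num_div_den _).symm
  generalize (I.weight s(u, v)).num = c at h5 ⊢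
  generalize (I.weight s(u, v)).den = d at h4 h5 ⊢
  rw [h5]
  push_cast
  field_simp

open Classical in
theorem arc_raw (a b u v : Fin n) : I.raw.arc a b u v = if I.graph.Adj u v ∧ s(u, v) ≠ s(a, b)
    then I.raw.wt u v else I.raw.big := by
  unfold RawInstance.arc
  split_ifs with h
  · have h1 := (I.adj_raw u v).2 h.1
    have h2 : ((natEq u a && natEq v b) || (natEq u b && natEq v a)) = false := by
      rw [← Bool.not_eq_true]
      intro h3
      apply h.2
      rw [Sym2.eq_iff]
      simpa [← Fin.ext_iff] using h3
    rw [h1, h2]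
    rfl
  · have h2 : (I.raw.adj u v && !((natEq u a && natEq v b) || (natEq u b && natEq v a))) =
        false := by
      rw [← Bool.not_eq_true]
      intro h3
      rw [Bool.and_eq_true, adj_raw, Bool.not_eq_true', ← Bool.not_eq_true] at h3
      refine h ⟨h3.1, fun h4 => h3.2 ?_⟩
      rw [Sym2.eq_iff] at h4
      simpa [← Fin.ext_iff] using h4
    rw [h2]
    rfl

/-- The scaled weight of a walk. -/
noncomputable def natWeight {x y : Fin n} (p : I.graph.Walk x y) : ℕ :=
  (p.darts.map fun d => I.raw.wt d.fst d.snd).sum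

theorem natWeight_eq {x y : Fin n} (p : I.graph.Walk x y) :
    (I.natWeight p : ℚ≥0) = walkWeight I.weight p * I.raw.commonDen := by
  induction p with
  | nil => simp [natWeight, walkWeight]
  | cons h p ih =>
    simp only [natWeight, walkWeight, SimpleGraph.Walk.darts_cons, SimpleGraph.Walk.edges_cons,
      List.map_cons, List.sum_cons, Nat.cast_add] at ih ⊢
    rw [ih, I.wt_raw h, add_mul]

theorem natWeight_le_iff {x y : Fin n} {p q : I.graph.Walk x y} :
    I.natWeight p ≤ I.natWeight q ↔ walkWeight I.weight p ≤ walkWeight I.weight q := by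
  have : (0 : ℚ≥0) < I.raw.commonDen := by exact_mod_cast I.commonDen_raw_pos
  rw [← Nat.cast_le (α := ℚ≥0), natWeight_eq, natWeight_eq, mul_le_mul_iff_left₀ this]

theorem big_raw : I.raw.big = ∑ u : Fin n, ∑ v : Fin n, I.raw.wt u v + 1 := by
  simp only [RawInstance.big, verts_raw, sum_map_range]

/-- A path repeats no dart, and `big` exceeds the sum over all ordered pairs. -/
theorem natWeight_lt_big {x y : Fin n} {p : I.graph.Walk x y} (hp : p.IsPath) :
    I.natWeight p < I.raw.big := by
  rw [big_raw, Nat.lt_succ_iff, ← Finset.sum_product', natWeight]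
  have h1 : (p.darts.map fun d => (d.fst, d.snd)).Nodup :=
    hp.isTrail.edges_nodup.of_map _ |>.map fun d d' h => by
      ext <;> simp_all
  have h2 : p.darts.map (fun d => I.raw.wt d.fst d.snd) =
      (p.darts.map fun d => (d.fst, d.snd)).map fun z => I.raw.wt z.1 z.2 := by simp
  rw [h2, ← List.sum_toFinset _ h1]
  exact Finset.sum_le_sum_of_subset (Finset.subset_univ _)

/-- The result of `k` rounds of the Bellman–Ford algorithm. -/
noncomputable def approxDist (a b x : Fin n) (k : ℕ) (y : Fin n) : ℕ :=
  ((I.raw.relax a b)^[k] (I.raw.init x)).getD y 0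

variable {a b x y z : Fin n}

theorem approxDist_zero : I.approxDist a b x 0 y = if x = y then 0 else I.raw.big := by
  simp only [approxDist, Function.iterate_zero, id, RawInstance.init, verts_raw, getD_map_range]
  split_ifs with h
  · have : natEq x y = true := natEq_iff.2 (by rw [h])
    rw [this, cond_true]
  · have : natEq x y = false := by
      rw [← Bool.not_eq_true, natEq_iff, ← Fin.ext_iff]
      exact h
    rw [this, cond_false]

theorem approxDist_succ (k : ℕ) : I.approxDist a b x (k + 1) y = minList (I.approxDist a b x k y)
    ((List.range n).map fun z =>
      ((I.raw.relax a b)^[k] (I.raw.init x)).getD z 0 + I.raw.arc a b z y) := by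
  simp only [approxDist]
  rw [Function.iterate_succ_apply']
  generalize (I.raw.relax a b)^[k] (I.raw.init x) = d
  unfold RawInstance.relax
  rw [verts_raw, getD_map_range]

theorem approxDist_succ_le (k : ℕ) : I.approxDist a b x (k + 1) y ≤ I.approxDist a b x k y := by
  rw [approxDist_succ]
  exact (minList_le _ _).1

theorem approxDist_antitone : Antitone fun k => I.approxDist a b x k y :=
  antitone_nat_of_succ_le fun k => I.approxDist_succ_le k

theorem approxDist_succ_le_add (k : ℕ) :
    I.approxDist a b x (k + 1) y ≤ I.approxDist a b x k z + I.raw.arc a b z y := by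
  rw [approxDist_succ]
  exact (minList_le _ _).2 _ (List.mem_map.2 ⟨z, List.mem_range.2 z.2, rfl⟩)

theorem approxDist_succ_eq (k : ℕ) : I.approxDist a b x (k + 1) y = I.approxDist a b x k y ∨
    ∃ z : Fin n, I.approxDist a b x (k + 1) y = I.approxDist a b x k z + I.raw.arc a b z y := by
  rw [approxDist_succ]
  refine (minList_mem _ _).imp id fun h => ?_
  obtain ⟨z, hz, h⟩ := List.mem_map.1 h
  exact ⟨⟨z, List.mem_range.1 hz⟩, h.symm⟩

/-- One round of relaxation per edge of the walk. -/
theorem approxDist_add_length_le (k : ℕ) (p : I.graph.Walk z y) (hp : s(a, b) ∉ p.edges) :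
    I.approxDist a b x (k + p.length) y ≤ I.approxDist a b x k z + I.natWeight p := by
  induction p generalizing k with
  | nil => simp [natWeight]
  | @cons z z' y h p ih =>
    rw [SimpleGraph.Walk.edges_cons, List.mem_cons, not_or] at hp
    have h1 := ih (k + 1) hp.2
    have h2 := I.approxDist_succ_le_add (a := a) (b := b) (x := x) (y := z') (z := z) k
    rw [arc_raw, if_pos ⟨h, Ne.symm hp.1⟩] at h2
    have h3 : I.natWeight (.cons h p) = I.raw.wt z z' + I.natWeight p := by simp [natWeight]
    rw [SimpleGraph.Walk.length_cons, h3, show k + (p.length + 1) = k + 1 + p.length by ring]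
    omega

/-- Every use of a missing or avoided arc adds `big`, so a value below `big` is realised by a
genuine walk. -/
theorem approxDist_cases (k : ℕ) : I.raw.big ≤ I.approxDist a b x k y ∨
    ∃ p : I.graph.Walk x y, s(a, b) ∉ p.edges ∧ I.natWeight p = I.approxDist a b x k y := by
  induction k generalizing y with
  | zero =>
    rw [approxDist_zero]
    split_ifs with h
    · subst h
      exact .inr ⟨.nil, by simp, by simp [natWeight]⟩
    · exact .inl le_rfl
  | succ k ih =>
    rcases I.approxDist_succ_eq (a := a) (b := b) (x := x) (y := y) k with h | ⟨z, h⟩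
    · rw [h]
      exact ih
    · rw [h, arc_raw]
      split_ifs with h1
      · rcases ih (y := z) with h2 | ⟨p, h2, h3⟩
        · exact .inl (by omega)
        · refine .inr ⟨p.concat h1.1, ?_, ?_⟩
          · rw [SimpleGraph.Walk.edges_concat, List.concat_eq_append, List.mem_append, not_or]
            exact ⟨h2, by simpa [eq_comm] using h1.2⟩
          · rw [← h3]
            simp [natWeight, SimpleGraph.Walk.darts_concat]
      · exact .inl (by omega)

theorem getD_dist : (I.raw.dist a b x).getD y 0 = I.approxDist a b x n y := by
  simp [RawInstance.dist, approxDist, List.foldl_const]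

/-- The distance computation decides which pairs monitor which edges. -/
theorem mon_raw (hI : I.graph.Connected) {u v : Fin n} :
    I.raw.mon x y u v = true ↔ Monitors I.graph I.weight x y s(u, v) := by
  unfold RawInstance.mon
  rw [getD_dist, getD_dist, Bool.and_eq_true, Bool.not_eq_true', Bool.not_eq_true',
    ← Bool.not_eq_true, ← Bool.not_eq_true, natEq_iff, natEq_iff, ← Fin.ext_iff]
  obtain ⟨p, hp⟩ := exists_isShortestPath (w := I.weight) (hI x y)
  have hp' := isShortestPath_iff.1 hp
  have hmin : ∀ q : I.graph.Walk x y, I.natWeight p ≤ I.natWeight q := fun q =>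
    I.natWeight_le_iff.2 (hp'.2 q)
  have hbig := I.natWeight_lt_big hp.1
  have hlow (a b : Fin n) : I.natWeight p ≤ I.approxDist a b x n y := by
    rcases I.approxDist_cases (a := a) (b := b) (x := x) (y := y) n with h | ⟨q, -, h⟩
    · omega
    · rw [← h]
      exact hmin q
  -- A path has fewer than `n` edges, so `n` rounds suffice.
  have hup (a b : Fin n) (q : I.graph.Walk x y) (hq : q.IsPath) (h : s(a, b) ∉ q.edges) :
      I.approxDist a b x n y ≤ I.natWeight q := by
    have h1 := I.approxDist_add_length_le (x := x) 0 q h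
    rw [approxDist_zero, if_pos rfl, zero_add, zero_add] at h1
    have h2 := hq.length_lt
    rw [Fintype.card_fin] at h2
    exact (I.approxDist_antitone h2.le).trans h1
  -- There are no loops, so avoiding s(x, x) is no restriction and this is the true distance.
  have hd : I.approxDist x x x n y = I.natWeight p :=
    le_antisymm (hup x x p hp.1 fun h => I.graph.loopless.irrefl x
      (SimpleGraph.Walk.edges_subset_edgeSet p h)) (hlow x x)
  rw [hd]
  refine and_congr_right fun hxy => ⟨fun h q hq => ?_, fun h h' => ?_⟩
  · by_contra hq'
    refine h (le_antisymm (hlow u v) ((hup u v q hq.1 hq').trans ?_))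
    exact I.natWeight_le_iff.2 ((isShortestPath_iff.1 hq).2 p)
  -- Equal distances lie below `big`, so a minimum walk that avoids the edge exists.
  · rcases I.approxDist_cases (a := u) (b := v) (x := x) (y := y) n with h1 | ⟨q, h1, h2⟩
    · omega
    · refine h1 ((monitors_iff.1 ⟨hxy, h⟩).2 q fun r => ?_)
      rw [← I.natWeight_le_iff, h2, ← h']
      exact hmin r

end Instance
end GMEG

namespace GMEG

/-! ### Analysis of the greedy algorithm -/

theorem any_range {n : ℕ} (f : ℕ → Bool) :
    (List.range n).any f = true ↔ ∃ i : Fin n, f i = true := by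
  rw [List.any_eq_true]
  exact ⟨fun ⟨i, h, h'⟩ => ⟨⟨i, List.mem_range.1 h⟩, h'⟩, fun ⟨i, h⟩ => ⟨i, List.mem_range.2 i.2, h⟩⟩

theorem length_filter_range {n : ℕ} (f : ℕ → Bool) :
    ((List.range n).filter f).length = (Finset.univ.filter fun i : Fin n => f i = true).card := by
  rw [← List.toFinset_card_of_nodup (List.nodup_range.filter _),
    ← Finset.card_map (Fin.valEmbedding)]
  congr 1
  ext i
  simp only [List.mem_toFinset, List.mem_filter, List.mem_range, Finset.mem_map,
    Finset.mem_filter, Finset.mem_univ, true_and, Fin.valEmbedding_apply]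
  exact ⟨fun h => ⟨⟨i, h.1⟩, h.2, rfl⟩, by rintro ⟨j, h, rfl⟩; exact ⟨j.2, h⟩⟩

/-- The set of vertices described by a list of truth values. -/
def Mask.toSet (n : ℕ) (M : Mask) : Finset (Fin n) := Finset.univ.filter fun v => M.getD v false = true

theorem Mask.mem_toSet {n : ℕ} {M : Mask} {v : Fin n} :
    v ∈ M.toSet n ↔ M.getD v false = true := by
  simp [Mask.toSet]

/-- Ties keep the earlier element. Hence a greedy step leaves a solution unchanged, and surplus
steps cost nothing. -/
theorem argminList_eq_self {α : Type} {key : α → ℕ} {b : α} {l : List α} (h : key b = 0) :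
    argminList key b l = b := by
  induction l with
  | nil => rfl
  | cons a l ih =>
    have h1 : argminList key b (a :: l) =
      argminList key (cond (natLt (key a) (key b)) a b) l := rfl
    have h2 : natLt (key a) (key b) = false := by
      rw [← Bool.not_eq_true, natLt_iff, h]
      omega
    rw [h1, h2, cond_false, ih]

namespace Instance

variable {n : ℕ} (I : Instance n)

open Classical in
/-- The ordered pairs that represent edges not monitored by `M`. -/
noncomputable def unmonitored (M : Finset (Fin n)) : Finset (Fin n × Fin n) :=
  Finset.univ.filter fun e => s(e.1, e.2) ∈ I.target ∧
    ¬∃ x ∈ M, ∃ y ∈ M, Monitors I.graph I.weight x y s(e.1, e.2)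

theorem unmonitored_eq_empty {M : Finset (Fin n)} : I.unmonitored M = ∅ ↔ I.IsSolution M := by
  simp only [unmonitored, Finset.filter_eq_empty_iff, Finset.mem_univ, true_implies, not_and,
    not_not, Prod.forall, IsSolution]
  exact ⟨fun h e => Sym2.ind (fun u v => h u v) e, fun h u v => h s(u, v)⟩

variable (hI : I.graph.Connected)

include hI

theorem covers_raw (M : Mask) (u v : Fin n) : I.raw.covers M u v = true ↔
    ∃ x ∈ M.toSet n, ∃ y ∈ M.toSet n, Monitors I.graph I.weight x y s(u, v) := by
  simp only [RawInstance.covers, verts_raw, any_range, Bool.and_eq_true, Mask.mem_toSet,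
    I.mon_raw hI]

theorem uncov_raw (M : Mask) : I.raw.uncov M = (I.unmonitored (M.toSet n)).card := by
  classical
  simp only [RawInstance.uncov, verts_raw, sum_map_range, length_filter_range, unmonitored]
  rw [Finset.card_filter, Fintype.sum_prod_type]
  refine Finset.sum_congr rfl fun u _ => ?_
  rw [Finset.card_filter]
  refine Finset.sum_congr rfl fun v _ => ?_
  congr 1
  rw [Bool.and_eq_true, Bool.not_eq_true', ← Bool.not_eq_true, I.covers_raw hI, target_raw]

omit hI

theorem toSet_addPair (M : Mask) (x y : Fin n) :
    (I.raw.addPair M x y).toSet n = M.toSet n ∪ {x, y} := by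
  ext v
  rw [Mask.mem_toSet, RawInstance.addPair, verts_raw, getD_map_range]
  simp only [Bool.or_eq_true, natEq_iff, Finset.mem_union, Mask.mem_toSet, Finset.mem_insert,
    Finset.mem_singleton, Fin.ext_iff]

theorem toSet_compl (X : Mask) : (I.raw.compl X).toSet n = (X.toSet n)ᶜ := by
  ext v
  rw [Mask.mem_toSet, RawInstance.compl, verts_raw, getD_map_range]
  simp [Mask.mem_toSet]

theorem toSet_inter (M M' : Mask) : (I.raw.inter M M').toSet n = M.toSet n ∩ M'.toSet n := by
  ext v
  rw [Mask.mem_toSet, RawInstance.inter, verts_raw, getD_map_range]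
  simp [Mask.mem_toSet]

theorem length_members (X : Mask) : (I.raw.members X).length = (X.toSet n).card := by
  rw [RawInstance.members, verts_raw, length_filter_range]
  rfl

theorem greedyStep_cases (M : Mask) :
    I.raw.greedyStep M = M ∨ ∃ x y : Fin n, I.raw.greedyStep M = I.raw.addPair M x y := by
  unfold RawInstance.greedyStep
  rcases argminList_mem I.raw.uncov M (I.raw.verts.map fun x =>
    argminList I.raw.uncov M (I.raw.verts.map (I.raw.addPair M x))) with h | h
  · exact .inl h
  · obtain ⟨x, hx, h⟩ := List.mem_map.1 h
    rw [← h]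
    rcases argminList_mem I.raw.uncov M (I.raw.verts.map (I.raw.addPair M x)) with h' | h'
    · exact .inl h'
    · obtain ⟨y, hy, h'⟩ := List.mem_map.1 h'
      rw [verts_raw, List.mem_range] at hx hy
      exact .inr ⟨⟨x, hx⟩, ⟨y, hy⟩, h'.symm⟩

theorem uncov_greedyStep_le (M : Mask) (x y : Fin n) :
    I.raw.uncov (I.raw.greedyStep M) ≤ I.raw.uncov (I.raw.addPair M x y) := by
  have h (i : Fin n) : (i : ℕ) ∈ I.raw.verts := by
    rw [verts_raw]
    exact List.mem_range.2 i.2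
  exact (key_argminList_le I.raw.uncov M _ _ (List.mem_cons_of_mem _
    (List.mem_map_of_mem (h x)))).trans (key_argminList_le I.raw.uncov M _ _
      (List.mem_cons_of_mem _ (List.mem_map_of_mem (h y))))

theorem greedyStep_eq_self {M : Mask} (h : I.raw.uncov M = 0) : I.raw.greedyStep M = M :=
  argminList_eq_self h

theorem greedy_eq (X : Mask) :
    I.raw.greedy X = I.raw.greedyStep^[n * n] (I.raw.compl X) := by
  simp only [RawInstance.greedy, List.foldl_const, verts_raw, List.length_range,
    Function.iterate_mul]

theorem compl_subset_iterate (X : Mask) (k : ℕ) :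
    (X.toSet n)ᶜ ⊆ (I.raw.greedyStep^[k] (I.raw.compl X)).toSet n := by
  induction k with
  | zero => rw [Function.iterate_zero, id, toSet_compl]
  | succ k ih =>
    rw [Function.iterate_succ_apply']
    rcases I.greedyStep_cases (I.raw.greedyStep^[k] (I.raw.compl X)) with h | ⟨x, y, h⟩
    · rwa [h]
    · rw [h, toSet_addPair]
      exact ih.trans Finset.subset_union_left

theorem card_iterate_inter_le (X : Mask) (k : ℕ) :
    ((I.raw.greedyStep^[k] (I.raw.compl X)).toSet n ∩ X.toSet n).card ≤ 2 * k := by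
  induction k with
  | zero =>
    rw [Function.iterate_zero, id, toSet_compl,
      Finset.disjoint_iff_inter_eq_empty.1 disjoint_compl_left, Finset.card_empty]
  | succ k ih =>
    rw [Function.iterate_succ_apply']
    rcases I.greedyStep_cases (I.raw.greedyStep^[k] (I.raw.compl X)) with h | ⟨x, y, h⟩
    · rw [h]
      omega
    · rw [h, toSet_addPair, Finset.union_inter_distrib_right]
      refine (Finset.card_union_le _ _).trans ?_
      have h1 := (Finset.card_le_card (Finset.inter_subset_left (s₁ := {x, y})
        (s₂ := X.toSet n))).trans Finset.card_le_two
      omega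

variable {I} {O : Finset (Fin n)}

theorem IsSolution.uncov_eq_zero (hI : I.graph.Connected) (hO : I.IsSolution O) {X : Mask}
    (h : O ∩ X.toSet n = ∅) : I.raw.uncov (I.raw.compl X) = 0 := by
  rw [I.uncov_raw hI, toSet_compl, Finset.card_eq_zero, unmonitored_eq_empty]
  refine hO.mono fun v hv => Finset.mem_compl.2 fun hv' => ?_
  have : v ∈ O ∩ X.toSet n := Finset.mem_inter.2 ⟨hv, hv'⟩
  rw [h] at this
  exact absurd this (Finset.notMem_empty v)

/-- A step of the greedy algorithm monitors at least the average, over the pairs of vertices of a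
solution, of the numbers of edges that they monitor. -/
theorem IsSolution.uncov_greedyStep (hI : I.graph.Connected) (hO : I.IsSolution O) {X M : Mask}
    (hM : (X.toSet n)ᶜ ⊆ M.toSet n) (hne : (O ∩ X.toSet n).Nonempty) :
    I.raw.uncov M + (O ∩ X.toSet n).card ^ 2 * I.raw.uncov (I.raw.greedyStep M) ≤
      (O ∩ X.toSet n).card ^ 2 * I.raw.uncov M := by
  classical
  set Y := O ∩ X.toSet n with hY
  obtain ⟨z, hz⟩ := hne
  -- The |Y|² pairs from `Y` together remove everything unmonitored, and the greedy step gains at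
  -- least as much as each of them.
  have hcov : I.unmonitored (M.toSet n) ⊆ (Y ×ˢ Y).biUnion fun p =>
      I.unmonitored (M.toSet n) \ I.unmonitored ((I.raw.addPair M p.1 p.2).toSet n) := by
    rintro ⟨u, v⟩ he
    have he' := he
    simp only [unmonitored, Finset.mem_filter, Finset.mem_univ, true_and] at he'
    obtain ⟨x, hx, y, hy, hm⟩ := hO _ he'.1
    -- A vertex of `O` outside `X` is already in `M`, so an arbitrary `z ∈ Y` may take its place in
    -- the pair.
    have key : ∀ x ∈ O, ∃ x' ∈ Y, x ∈ M.toSet n ∨ x = x' := fun x hx => by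
      by_cases h : x ∈ X.toSet n
      · exact ⟨x, Finset.mem_inter.2 ⟨hx, h⟩, .inr rfl⟩
      · exact ⟨z, hz, .inl (hM (Finset.mem_compl.2 h))⟩
    obtain ⟨x', hx', hxx⟩ := key x hx
    obtain ⟨y', hy', hyy⟩ := key y hy
    refine Finset.mem_biUnion.2 ⟨(x', y'), Finset.mem_product.2 ⟨hx', hy'⟩,
      Finset.mem_sdiff.2 ⟨he, fun h => ?_⟩⟩
    simp only [unmonitored, Finset.mem_filter, Finset.mem_univ, true_and] at h
    refine h.2 ⟨x, ?_, y, ?_, hm⟩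
    · rw [toSet_addPair, Finset.mem_union]
      exact hxx.imp_right fun h => by simp [h]
    · rw [toSet_addPair, Finset.mem_union]
      exact hyy.imp_right fun h => by simp [h]
  have h1 : (I.unmonitored (M.toSet n)).card ≤
      (Y ×ˢ Y).card * (I.raw.uncov M - I.raw.uncov (I.raw.greedyStep M)) := by
    refine (Finset.card_le_card hcov).trans (Finset.card_biUnion_le_card_mul _ _ _ fun p _ => ?_)
    have h2 : I.unmonitored ((I.raw.addPair M p.1 p.2).toSet n) ⊆ I.unmonitored (M.toSet n) := by
      intro e he
      simp only [unmonitored, Finset.mem_filter, Finset.mem_univ, true_and] at he ⊢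
      refine ⟨he.1, fun ⟨x, hx, y, hy, hm⟩ => he.2 ⟨x, ?_, y, ?_, hm⟩⟩ <;>
      rw [toSet_addPair] <;> exact Finset.mem_union_left _ ‹_›
    rw [Finset.card_sdiff_of_subset h2, ← I.uncov_raw hI, ← I.uncov_raw hI]
    exact Nat.sub_le_sub_left (I.uncov_greedyStep_le M p.1 p.2) _
  rw [← I.uncov_raw hI, Finset.card_product, ← sq] at h1
  have h3 : I.raw.uncov (I.raw.greedyStep M) ≤ I.raw.uncov M := by
    exact key_argminList_le I.raw.uncov M _ _ List.mem_cons_self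
  obtain ⟨d, hd⟩ := Nat.exists_eq_add_of_le h3
  rw [hd, Nat.add_sub_cancel_left] at h1
  rw [hd]
  nlinarith

theorem iterate_greedyStep_eq {M : Mask} {j k : ℕ} (h : I.raw.uncov (I.raw.greedyStep^[j] M) = 0)
    (hjk : j ≤ k) : I.raw.greedyStep^[k] M = I.raw.greedyStep^[j] M := by
  obtain ⟨d, rfl⟩ := Nat.exists_eq_add_of_le hjk
  rw [add_comm, Function.iterate_add_apply]
  exact Function.iterate_fixed (I.greedyStep_eq_self h) d

/-- Comparison with the solution `univ` shows that each step lowers a positive `uncov`, which is at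
most `n * n` initially. The logarithmic estimate alone would not do, as its number of steps may
exceed `n * n`. -/
theorem isSolution_greedy (hI : I.graph.Connected) (hO : I.IsSolution O) (X : Mask) :
    I.IsSolution ((I.raw.greedy X).toSet n) := by
  have hU : I.IsSolution Finset.univ := hO.mono (Finset.subset_univ _)
  rw [← unmonitored_eq_empty, ← Finset.card_eq_zero, ← I.uncov_raw hI, greedy_eq]
  rcases (Finset.univ ∩ X.toSet n).eq_empty_or_nonempty with h | h
  · have h1 := hU.uncov_eq_zero hI h
    rw [iterate_greedyStep_eq (M := I.raw.compl X) (j := 0) h1 (Nat.zero_le _)]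
    exact h1
  · have key : ∀ k, I.raw.uncov (I.raw.greedyStep^[k] (I.raw.compl X)) ≤ n * n - k := by
      intro k
      induction k with
      | zero =>
        rw [I.uncov_raw hI]
        exact (Finset.card_le_univ _).trans (by simp)
      | succ k ih =>
        rw [Function.iterate_succ_apply']
        have h1 := hU.uncov_greedyStep hI (I.compl_subset_iterate X k) h
        by_contra! h2
        have h3 : I.raw.uncov (I.raw.greedyStep^[k] (I.raw.compl X)) ≤
          I.raw.uncov (I.raw.greedyStep (I.raw.greedyStep^[k] (I.raw.compl X))) := by omega
        have h4 := Nat.mul_le_mul_left ((Finset.univ ∩ X.toSet n).card ^ 2) h3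
        have h5 : I.raw.uncov (I.raw.greedyStep^[k] (I.raw.compl X)) = 0 := by omega
        rw [I.greedyStep_eq_self h5, h5] at h2
        omega
    have := key (n * n)
    omega

/-- The cost of the greedy solution. -/
theorem IsSolution.card_greedy_le (hI : I.graph.Connected) (hO : I.IsSolution O) (hn : 0 < n)
    {X : Mask} (hne : (O ∩ X.toSet n).Nonempty) :
    (((I.raw.greedy X).toSet n ∩ X.toSet n).card : ℝ) ≤
      4 * (O ∩ X.toSet n).card ^ 2 * Real.log n + 2 := by
  set o : ℝ := ((O ∩ X.toSet n).card : ℝ) with ho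
  have ho1 : 1 ≤ o := Nat.one_le_cast.2 hne.card_pos
  have hn' : (0 : ℝ) < n := by exact_mod_cast hn
  have hlog : 0 ≤ Real.log n := Real.log_natCast_nonneg n
  -- Each step multiplies the count by at most 1 - 1/o² ≤ exp(-1/o²).
  have key : ∀ k : ℕ, (I.raw.uncov (I.raw.greedyStep^[k] (I.raw.compl X)) : ℝ) ≤
      n ^ 2 * Real.exp (-k / o ^ 2) := by
    intro k
    induction k with
    | zero =>
      rw [I.uncov_raw hI]
      have := Finset.card_le_univ (I.unmonitored (Mask.toSet n (I.raw.compl X)))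
      rw [Fintype.card_prod, Fintype.card_fin, ← sq] at this
      simpa using (Nat.cast_le (α := ℝ)).2 this
    | succ k ih =>
      rw [Function.iterate_succ_apply']
      have h1 := hO.uncov_greedyStep hI (I.compl_subset_iterate X k) hne
      have h2 : (I.raw.uncov (I.raw.greedyStep^[k] (I.raw.compl X)) : ℝ) + o ^ 2 *
          I.raw.uncov (I.raw.greedyStep (I.raw.greedyStep^[k] (I.raw.compl X))) ≤
          o ^ 2 * I.raw.uncov (I.raw.greedyStep^[k] (I.raw.compl X)) := by
        rw [ho]
        exact_mod_cast h1
      set a : ℝ := (I.raw.uncov (I.raw.greedyStep^[k] (I.raw.compl X)) : ℝ)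
      set b : ℝ := (I.raw.uncov (I.raw.greedyStep (I.raw.greedyStep^[k] (I.raw.compl X))) : ℝ)
      have ha : 0 ≤ a := Nat.cast_nonneg _
      have ho2 : 0 < o ^ 2 := by positivity
      have h3 : b ≤ a * (1 - 1 / o ^ 2) := by
        rw [mul_sub, mul_one, mul_one_div, le_sub_iff_add_le, ← le_sub_iff_add_le',
          div_le_iff₀ ho2]
        linarith
      have h4 : 1 - 1 / o ^ 2 ≤ Real.exp (-(1 / o ^ 2)) := by
        have := Real.add_one_le_exp (-(1 / o ^ 2))
        linarith
      calc b ≤ a * Real.exp (-(1 / o ^ 2)) := h3.trans (mul_le_mul_of_nonneg_left h4 ha)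
        _ ≤ n ^ 2 * Real.exp (-k / o ^ 2) * Real.exp (-(1 / o ^ 2)) :=
          mul_le_mul_of_nonneg_right ih (Real.exp_pos _).le
        _ = _ := by
          rw [mul_assoc, ← Real.exp_add]
          congr 2
          push_cast
          ring
  -- Chosen so that n² exp(-k/o²) < 1; a natural number below 1 is 0.
  set k := ⌊2 * o ^ 2 * Real.log n⌋₊ + 1 with hk
  have h1 : I.raw.uncov (I.raw.greedyStep^[k] (I.raw.compl X)) = 0 := by
    have h2 : (2 * o ^ 2 * Real.log n : ℝ) < k := by
      rw [hk]
      push_cast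
      exact Nat.lt_floor_add_one _
    have h3 : -(k : ℝ) / o ^ 2 < -(2 * Real.log n) := by
      rw [div_lt_iff₀ (by positivity)]
      linarith
    have h4 : (I.raw.uncov (I.raw.greedyStep^[k] (I.raw.compl X)) : ℝ) < 1 := by
      refine (key k).trans_lt ?_
      calc (n : ℝ) ^ 2 * Real.exp (-k / o ^ 2) < n ^ 2 * Real.exp (-(2 * Real.log n)) :=
            mul_lt_mul_of_pos_left (Real.exp_lt_exp.2 h3) (by positivity)
        _ = 1 := by
          rw [Real.exp_neg, two_mul, Real.exp_add, Real.exp_log hn']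
          field_simp
    have h5 : I.raw.uncov (I.raw.greedyStep^[k] (I.raw.compl X)) < 1 := by exact_mod_cast h4
    omega
  have h2 : ((I.raw.greedy X).toSet n ∩ X.toSet n).card ≤ 2 * k := by
    rw [greedy_eq]
    -- Either only `n * n ≤ k` steps are made, or the steps after the k-th change nothing.
    rcases le_total (n * n) k with h | h
    · exact (I.card_iterate_inter_le X _).trans (Nat.mul_le_mul_left 2 h)
    · rw [iterate_greedyStep_eq h1 h]
      exact I.card_iterate_inter_le X k
  have h3 : (k : ℝ) ≤ 2 * o ^ 2 * Real.log n + 1 := by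
    rw [hk]
    push_cast
    exact add_le_add_left (Nat.floor_le (by positivity)) _
  have h4 : (((I.raw.greedy X).toSet n ∩ X.toSet n).card : ℝ) ≤ 2 * k := by exact_mod_cast h2
  linarith

theorem IsSolution.card_greedy_eq_zero (hI : I.graph.Connected) (hO : I.IsSolution O) {X : Mask}
    (h : O ∩ X.toSet n = ∅) : ((I.raw.greedy X).toSet n ∩ X.toSet n).card = 0 := by
  rw [greedy_eq, iterate_greedyStep_eq (M := I.raw.compl X) (j := 0) (hO.uncov_eq_zero hI h) (Nat.zero_le _)]
  rw [Function.iterate_zero, id, toSet_compl,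
    Finset.disjoint_iff_inter_eq_empty.1 disjoint_compl_left, Finset.card_empty]

theorem compl_subset_greedy (X : Mask) : (X.toSet n)ᶜ ⊆ (I.raw.greedy X).toSet n := by
  rw [greedy_eq]
  exact I.compl_subset_iterate X _

end Instance
end GMEG

namespace GMEG
open Enc (enc)

/-! ### Separators of induced subgraphs -/

open Classical in
/-- The data of a graph. -/
noncomputable def rawGraph {m : ℕ} (G : SimpleGraph (Fin m)) : ℕ × List (List Bool) :=
  (m, List.ofFn fun u => List.ofFn fun v => decide (G.Adj u v))

theorem enc_rawGraph {m : ℕ} (G : SimpleGraph (Fin m)) : enc (rawGraph G) = encodeGraph G := by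
  show Val.pair (.num m) (enc (List.ofFn _)) = _
  rw [enc_ofFn]
  unfold encodeGraph
  congr! with u
  rw [enc_ofFn]
  congr 2
  funext v
  by_cases h : G.Adj u v <;> simp [enc, h]

theorem rawGraph_injective {m : ℕ} {G H : SimpleGraph (Fin m)} (h : rawGraph G = rawGraph H) :
    G = H := by
  ext u v
  have h1 := congrFun (List.ofFn_injective (congrFun (List.ofFn_injective (Prod.ext_iff.1 h).2) u)) v
  simpa using h1

/-- The list of truth values that describes a set of vertices. -/
def maskOf {m : ℕ} (S : Finset (Fin m)) : Mask := List.ofFn fun v => decide (v ∈ S)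

theorem enc_maskOf {m : ℕ} (S : Finset (Fin m)) : enc (maskOf S) = encodeSet S := by
  unfold maskOf encodeSet
  rw [enc_ofFn]
  simp [enc]

theorem Mask.maskOf_toSet {n : ℕ} {M : Mask} (h : M.length = n) : maskOf (M.toSet n) = M := by
  subst h
  refine List.ext_getElem (by simp [maskOf]) fun i h1 h2 => ?_
  simp [maskOf, Mask.mem_toSet]

theorem length_filter_maskOf {m : ℕ} (S : Finset (Fin m)) :
    ((maskOf S).filter fun b => b).length = S.card := by
  have h1 : maskOf S = (List.finRange m).map fun v => decide (v ∈ S) := by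
    rw [maskOf, List.ofFn_eq_map]
  rw [h1, List.filter_map, List.length_map, ← List.toFinset_card_of_nodup
    ((List.nodup_finRange m).filter _)]
  congr 1
  ext v
  simp

/-- Turns the separator algorithm into a function on codes that `solve` can call. The graph is
recovered from its code by choice, which is harmless by `rawGraph_injective`; values at other codes
are irrelevant. -/
theorem HasEfficientSeparators.exists_function {𝒢 : GraphClass} {α β : ℝ}
    (h : HasEfficientSeparators 𝒢 α β) : ∃ (n₀ : ℕ) (β₀ : ℝ)
      (sep : ℕ × List (List Bool) → Mask × (Mask × Mask)), 1 ≤ β₀ ∧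
      PolyTimeOn {g | ∃ (m : ℕ) (G : SimpleGraph (Fin m)), n₀ ≤ m ∧ 𝒢 m G ∧ rawGraph G = g} sep ∧
      ∀ (m : ℕ) (G : SimpleGraph (Fin m)), n₀ ≤ m → 𝒢 m G →
        ∃ S A B : Finset (Fin m), IsBalancedSeparator G α S A B ∧ (S.card : ℝ) ≤ β₀ * (m : ℝ) ^ β ∧
          sep (rawGraph G) = (maskOf S, (maskOf A, maskOf B)) := by
  obtain ⟨-, n₀, β₀, hβ₀, P, p, h⟩ := h
  choose! S A B hsep hcard hrun using h
  classical
  let sep : ℕ × List (List Bool) → Mask × (Mask × Mask) := fun g =>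
    if hg : ∃ G : SimpleGraph (Fin g.1), rawGraph G = g then
      (maskOf (S g.1 hg.choose), (maskOf (A g.1 hg.choose), maskOf (B g.1 hg.choose)))
    else ([], ([], []))
  have hsep' : ∀ (m : ℕ) (G : SimpleGraph (Fin m)),
      sep (rawGraph G) = (maskOf (S m G), (maskOf (A m G), maskOf (B m G))) := by
    intro m G
    have hg : ∃ G' : SimpleGraph (Fin (rawGraph G).1), rawGraph G' = rawGraph G := ⟨G, rfl⟩
    have h1 : hg.choose = G := rawGraph_injective hg.choose_spec
    show (if hg : ∃ G' : SimpleGraph (Fin (rawGraph G).1), rawGraph G' = rawGraph G then _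
      else _) = _
    rw [dif_pos hg, h1]
    rfl
  refine ⟨n₀, β₀, sep, hβ₀, ?_, fun m G hm hG =>
    ⟨S m G, A m G, B m G, hsep m G hm hG, hcard m G hm hG, hsep' m G⟩⟩
  refine PolyTimeOn.of_polyBdd (T := fun g => p.eval (esize g)) P (PolyBdd.self.eval p)
    (PolyBdd.mono (g := fun g => (esize g * 3 + 1) + ((esize g * 3 + 1) + (esize g * 3 + 1) + 1) + 1)
      ?_ ?_) ?_
  · have h3 : PolyBdd {g | ∃ (m : ℕ) (G : SimpleGraph (Fin m)), n₀ ≤ m ∧ 𝒢 m G ∧ rawGraph G = g}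
      fun g => esize g * 3 + 1 := (PolyBdd.self.mul (.const 3)).add (.const 1)
    exact (h3.add ((h3.add h3).add (.const 1))).add (.const 1)
  · rintro g ⟨m, G, hm, hG, rfl⟩
    rw [hsep', esize_prod, esize_prod]
    have h3 : m ≤ esize (rawGraph G) := by
      have h4 := length_lt_esize (rawGraph G).2
      rw [esize_prod]
      simp only [rawGraph, List.length_ofFn] at h4 ⊢
      omega
    have h4 (S : Finset (Fin m)) : esize (maskOf S) ≤ esize (rawGraph G) * 3 + 1 :=
      PolyTime.esize_mask_le (by simpa [maskOf] using h3)
    have := h4 (S m G)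
    have := h4 (A m G)
    have := h4 (B m G)
    dsimp only
    omega
  · rintro g ⟨m, G, hm, hG, rfl⟩
    rw [hsep', enc_rawGraph]
    obtain ⟨t, h1, h2⟩ := hrun m G hm hG
    refine ⟨t, ?_, ?_⟩
    · show Run P _ (.pair (enc (maskOf (S m G))) (.pair (enc (maskOf (A m G)))
        (enc (maskOf (B m G))))) t
      rwa [enc_maskOf, enc_maskOf, enc_maskOf]
    · rwa [esize, enc_rawGraph]

namespace Instance

variable {n : ℕ} (I : Instance n)

/-- The vertex of the graph that corresponds to a vertex of an induced subgraph. -/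
noncomputable def inclusion (X : Mask) (i : Fin (I.raw.members X).length) : Fin n :=
  ⟨(I.raw.members X)[i], by
    have h : ∀ a ∈ I.raw.members X, a < n := fun a ha => by
      rw [RawInstance.members, verts_raw, List.mem_filter, List.mem_range] at ha
      exact ha.1
    exact h _ (List.getElem_mem i.2)⟩

theorem inclusion_injective (X : Mask) : Function.Injective (I.inclusion X) := by
  intro i j h
  have h1 : (I.raw.members X).Nodup := by
    rw [RawInstance.members, verts_raw]
    exact List.nodup_range.filter _
  have h2 : (I.raw.members X)[i] = (I.raw.members X)[j] := congrArg Fin.val h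
  exact Fin.ext ((h1.getElem_inj_iff).1 h2)

theorem inducedGraph_raw (X : Mask) :
    I.raw.inducedGraph X = rawGraph (I.graph.comap (I.inclusion X)) := by
  classical
  unfold RawInstance.inducedGraph rawGraph
  refine Prod.ext rfl ?_
  have key {α : Type} (f : ℕ → α) : (I.raw.members X).map f =
      List.ofFn fun i : Fin (I.raw.members X).length => f (I.inclusion X i) := by
    refine List.ext_getElem (by simp) fun i h1 h2 => ?_
    simp [inclusion]
  dsimp only
  rw [key]
  congr 1
  funext u
  rw [key]
  congr 1
  funext v
  rw [Bool.eq_iff_iff, adj_raw, decide_eq_true_iff]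
  rfl

theorem range_inclusion (X : Mask) : Finset.univ.map ⟨_, I.inclusion_injective X⟩ = X.toSet n := by
  ext v
  rw [Mask.mem_toSet]
  simp only [Finset.mem_map, Finset.mem_univ, true_and, Function.Embedding.coeFn_mk]
  have h : (v : ℕ) ∈ I.raw.members X ↔ X.getD v false = true := by
    rw [RawInstance.members, verts_raw, List.mem_filter, List.mem_range]
    simp
  rw [← h, List.mem_iff_getElem]
  exact ⟨fun ⟨i, hi⟩ => ⟨i, i.2, congrArg Fin.val hi⟩, fun ⟨i, h1, h2⟩ => ⟨⟨i, h1⟩, Fin.ext h2⟩⟩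

theorem toSet_lift (X : Mask) (A : Finset (Fin (I.raw.members X).length)) :
    (I.raw.lift X (maskOf A)).toSet n = A.map ⟨_, I.inclusion_injective X⟩ := by
  ext v
  rw [Mask.mem_toSet, RawInstance.lift, verts_raw, getD_map_range, any_range]
  simp only [Bool.and_eq_true, maskOf, getD_ofFn, decide_eq_true_iff, natEq_iff, Finset.mem_map,
    Function.Embedding.coeFn_mk]
  refine exists_congr fun i => and_congr_right fun _ => ?_
  rw [List.getD_eq_getElem _ _ i.2, Fin.ext_iff]
  rfl

/-- The effect of a separator of the subgraph induced by a set of vertices. -/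
theorem exists_separator {𝒢 : GraphClass} {α β β₀ : ℝ} {n₀ : ℕ}
    {sep : ℕ × List (List Bool) → Mask × (Mask × Mask)} (hher : Hereditary 𝒢) (hI : 𝒢 n I.graph)
    (hsep : ∀ (m : ℕ) (G : SimpleGraph (Fin m)), n₀ ≤ m → 𝒢 m G →
        ∃ S A B : Finset (Fin m), IsBalancedSeparator G α S A B ∧ (S.card : ℝ) ≤ β₀ * (m : ℝ) ^ β ∧
          sep (rawGraph G) = (maskOf S, (maskOf A, maskOf B)))
    {X : Mask} (hX : n₀ ≤ (X.toSet n).card) :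
    ∃ S A B : Finset (Fin n), S.Nonempty ∧ A.Nonempty ∧ B.Nonempty ∧ Disjoint S A ∧ Disjoint S B ∧
      Disjoint A B ∧ S ∪ A ∪ B = X.toSet n ∧ (∀ a ∈ A, ∀ b ∈ B, ¬I.graph.Adj a b) ∧
      (A.card : ℝ) ≤ (1 - α) * (X.toSet n).card ∧ (B.card : ℝ) ≤ (1 - α) * (X.toSet n).card ∧
      (S.card : ℝ) ≤ β₀ * ((X.toSet n).card : ℝ) ^ β ∧
      ((sep (I.raw.inducedGraph X)).1.filter fun b => b).length = S.card ∧
      (I.raw.lift X (sep (I.raw.inducedGraph X)).2.1).toSet n = A ∧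
      (I.raw.lift X (sep (I.raw.inducedGraph X)).2.2).toSet n = B := by
  rw [← I.length_members] at hX ⊢
  obtain ⟨S, A, B, h, hS, hs⟩ := hsep _ (I.graph.comap (I.inclusion X)) hX
    (hher _ _ _ _ hI ⟨SimpleGraph.Embedding.comap ⟨_, I.inclusion_injective X⟩ I.graph⟩)
  rw [inducedGraph_raw, hs]
  set f : Fin (I.raw.members X).length ↪ Fin n := ⟨_, I.inclusion_injective X⟩ with hf
  have hcard : S.card + A.card + B.card = (I.raw.members X).length := by
    rw [← Finset.card_union_of_disjoint h.disjoint_SA, ← Finset.card_union_of_disjoint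
      (Finset.disjoint_union_left.2 ⟨h.disjoint_SB, h.disjoint_AB⟩), h.union_eq]
    simp
  have hcard' : (S.card : ℝ) + A.card + B.card = (I.raw.members X).length := by
    exact_mod_cast hcard
  have hS0 : (0 : ℝ) ≤ S.card := Nat.cast_nonneg _
  have hbal := h.balanced
  rw [Fintype.card_fin, le_min_iff] at hbal
  refine ⟨S.map f, A.map f, B.map f, h.nonempty_S.map, h.nonempty_A.map, h.nonempty_B.map,
    (Finset.disjoint_map f).2 h.disjoint_SA, (Finset.disjoint_map f).2 h.disjoint_SB,
    (Finset.disjoint_map f).2 h.disjoint_AB, ?_, ?_, ?_, ?_, ?_, ?_, I.toSet_lift X A,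
    I.toSet_lift X B⟩
  · rw [← Finset.map_union, ← Finset.map_union, h.union_eq, I.range_inclusion]
  · intro a' ha' b' hb' hab
    obtain ⟨a, ha, rfl⟩ := Finset.mem_map.1 ha'
    obtain ⟨b, hb, rfl⟩ := Finset.mem_map.1 hb'
    have hab' : (I.graph.comap (I.inclusion X)).Adj a b := hab
    -- An edge from `A` to `B` is a path whose only vertices are its ends, and neither is in `S`.
    obtain ⟨s, hs, hs'⟩ := h.separates a ha b hb hab'.toWalk
      (SimpleGraph.Walk.IsPath.of_adj hab')
    have : s = a ∨ s = b := by simpa using hs'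
    rcases this with rfl | rfl
    · exact Finset.disjoint_left.1 h.disjoint_SA hs ha
    · exact Finset.disjoint_left.1 h.disjoint_SB hs hb
  -- A large other side leaves at most (1 - α)|X| vertices for this one.
  · rw [Finset.card_map]
    linarith [hbal.2]
  · rw [Finset.card_map]
    linarith [hbal.1]
  · rwa [Finset.card_map]
  · rw [Finset.card_map, length_filter_maskOf]

end Instance
end GMEG

namespace GMEG
open Enc (enc)

/-! ### Analysis of the algorithm -/

theorem RawInstance.length_solve (J : RawInstance) (n₀ : ℕ)
    (sep : ℕ × List (List Bool) → Mask × (Mask × Mask)) :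
    (J.solve n₀ sep).length = J.verts.length :=
  (foldl_induction (P := fun x : List Mask × Mask =>
    (∀ X ∈ x.1, X.length = J.verts.length) ∧ x.2.length = J.verts.length) (by simp [costly])
    fun x _ h => (workStep_bounds J x h).1).2

namespace Instance

variable {n : ℕ} {I : Instance n}

/-- The greedy solution is good enough if it costs at most as much as a separator. -/
theorem IsSolution.card_greedy_le_of_separator (hI : I.graph.Connected) {O : Finset (Fin n)}
    (hO : I.IsSolution O) (hn : 2 ≤ n) {X : Mask} {a t : ℝ} (ha : 0 ≤ a)
    (hag : a ≤ ((I.raw.greedy X).toSet n ∩ X.toSet n).card) (hat : a ≤ t ^ 2) (ht : 0 ≤ t) :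
    a ≤ √(Real.log n) * (√8 * t) * (O ∩ X.toSet n).card := by
  have hlog : Real.log 2 ≤ Real.log n := Real.log_le_log (by norm_num) (by exact_mod_cast hn)
  have hlog2 := Real.log_two_gt_d9
  rcases (O ∩ X.toSet n).eq_empty_or_nonempty with h | h
  · rw [hO.card_greedy_eq_zero hI h] at hag
    rw [h]
    simpa using hag
  · have h1 := hO.card_greedy_le hI (by omega) h
    have h2 : (1 : ℝ) ≤ (O ∩ X.toSet n).card := Nat.one_le_cast.2 h.card_pos
    set o : ℝ := ((O ∩ X.toSet n).card : ℝ)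
    -- The summand 2 is absorbed because 4 log n ≥ 4 log 2 > 2 and o ≥ 1.
    have h3 : a ≤ 8 * o ^ 2 * Real.log n := by
      have h4 : 1 ≤ o ^ 2 := one_le_pow₀ h2
      nlinarith
    -- The geometric mean of the bounds: a² = a · a ≤ (8 o² log n) · t².
    refine le_of_sq_le_sq ?_ (by positivity)
    have h5 : (√(Real.log n) * (√8 * t) * o) ^ 2 = (8 * o ^ 2 * Real.log n) * t ^ 2 := by
      rw [mul_pow, mul_pow, mul_pow, Real.sq_sqrt (by linarith), Real.sq_sqrt (by norm_num)]
      ring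
    rw [h5, sq]
    exact mul_le_mul h3 hat ha (by positivity)

/-- What the algorithm achieves on the set `X`, with ratio `√(log n) * Φ |X|`. -/
structure IsGood (I : Instance n) (Φ : ℕ → ℝ) (X R : Finset (Fin n)) : Prop where
  compl_subset : Xᶜ ⊆ R
  isSolution : I.IsSolution R
  eq_empty : ∀ O, I.IsSolution O → O ∩ X = ∅ → R ∩ X = ∅
  card_le : 2 ≤ n → ∀ O, I.IsSolution O →
    ((R ∩ X).card : ℝ) ≤ √(Real.log n) * Φ X.card * (O ∩ X).card

variable {n₀ : ℕ} {sep : ℕ × List (List Bool) → Mask × (Mask × Mask)} {α β β₀ : ℝ} {Φ : ℕ → ℝ}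

/-- Strong induction on |X|. The conditions on `Φ` pay for sets below `n₀`, for a cheap greedy
solution, and for a separator plus the recursion. The claim is made for every remaining stack `l`
and every `M`, so that it applies to one part while the other waits on the stack. -/
theorem exists_isGood {𝒢 : GraphClass} (hher : Hereditary 𝒢) (hG : 𝒢 n I.graph)
    (hI : I.graph.Connected) (hsol : ∃ M, I.IsSolution M) (hβ₀ : 1 ≤ β₀)
    (hsep : ∀ (m : ℕ) (G : SimpleGraph (Fin m)), n₀ ≤ m → 𝒢 m G →
      ∃ S A B : Finset (Fin m), IsBalancedSeparator G α S A B ∧ (S.card : ℝ) ≤ β₀ * (m : ℝ) ^ β ∧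
        sep (rawGraph G) = (maskOf S, (maskOf A, maskOf B)))
    (hΦ₀ : ∀ x : ℕ, 1 ≤ x → (n₀ : ℝ) ≤ √(Real.log 2) * Φ x)
    (hΦ₁ : ∀ x : ℕ, 1 ≤ x → √8 * √(β₀ * (x : ℝ) ^ β) ≤ Φ x)
    (hΦ₂ : ∀ x a : ℕ, 1 ≤ a → (a : ℝ) ≤ (1 - α) * x → √8 * √(β₀ * (x : ℝ) ^ β) + Φ a ≤ Φ x)
    (X : Mask) :
    ∃ R : Finset (Fin n), I.IsGood Φ (X.toSet n) R ∧ ∃ k ≤ 2 * (X.toSet n).card + 1,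
      ∀ (l : List Mask) (M : Mask), ∃ M' : Mask, M'.toSet n = M.toSet n ∩ R ∧
        (RawInstance.workStep n₀ sep I.raw)^[k] (X :: l, M) = (l, M') := by
  obtain ⟨M₀, hM₀⟩ := hsol
  induction hc : (X.toSet n).card using Nat.strong_induction_on generalizing X with
  | _ c ih =>
  subst hc
  have hlog : 2 ≤ n → √(Real.log 2) ≤ √(Real.log n) := fun hn =>
    Real.sqrt_le_sqrt (Real.log_le_log (by norm_num) (by exact_mod_cast hn))
  have hgreedy : ∀ O, I.IsSolution O → O ∩ X.toSet n = ∅ →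
      (I.raw.greedy X).toSet n ∩ X.toSet n = ∅ := fun O hO h =>
    Finset.card_eq_zero.1 (hO.card_greedy_eq_zero hI h)
  have hleaf : (∀ x : List Mask × Mask, x.1.getD 0 [] = X → isCons x.1 = true →
        RawInstance.workStep n₀ sep I.raw x = I.raw.leaf x) →
      (2 ≤ n → ∀ O, I.IsSolution O → (((I.raw.greedy X).toSet n ∩ X.toSet n).card : ℝ) ≤
        √(Real.log n) * Φ (X.toSet n).card * (O ∩ X.toSet n).card) →
      ∃ R : Finset (Fin n), I.IsGood Φ (X.toSet n) R ∧ ∃ k ≤ 2 * (X.toSet n).card + 1,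
      ∀ (l : List Mask) (M : Mask), ∃ M' : Mask, M'.toSet n = M.toSet n ∩ R ∧
        (RawInstance.workStep n₀ sep I.raw)^[k] (X :: l, M) = (l, M') := by
    intro h1 h2
    refine ⟨_, ⟨compl_subset_greedy X, isSolution_greedy hI hM₀ X, hgreedy, h2⟩, 1, by omega,
      fun l M => ⟨I.raw.inter M (I.raw.greedy X), I.toSet_inter _ _, ?_⟩⟩
    rw [Function.iterate_one, h1 (X :: l, M) rfl rfl]
    rfl
  by_cases hX : (X.toSet n).card < n₀
  · refine hleaf (fun x hx hx' => ?_) fun hn O hO => ?_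
    · have : natLt (I.raw.members X).length n₀ = true := by rwa [natLt_iff, I.length_members]
      unfold RawInstance.workStep
      rw [hx', hx, this]
      rfl
    · rcases (O ∩ X.toSet n).eq_empty_or_nonempty with h | h
      · rw [hgreedy O hO h, h]
        simp
      · have h1 : (1 : ℝ) ≤ (O ∩ X.toSet n).card := Nat.one_le_cast.2 h.card_pos
        have h2 : 1 ≤ (X.toSet n).card :=
          h.card_pos.trans_le (Finset.card_le_card Finset.inter_subset_right)
        have h3 := hΦ₀ _ h2
        have h4 : (((I.raw.greedy X).toSet n ∩ X.toSet n).card : ℝ) ≤ n₀ := by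
          exact_mod_cast (Finset.card_le_card Finset.inter_subset_right).trans hX.le
        have h5 : 0 ≤ Φ (X.toSet n).card := le_trans (by positivity) (hΦ₁ _ h2)
        have h6 := mul_le_mul_of_nonneg_right (hlog hn) h5
        have h7 : 0 ≤ √(Real.log n) * Φ (X.toSet n).card := by positivity
        nlinarith
  · rw [not_lt] at hX
    obtain ⟨S, A, B, hS, hA, hB, hSA, hSB, hAB, hun, hadj, hAc, hBc, hSc, hsl, hlA, hlB⟩ :=
      I.exists_separator hher hG hsep hX
    set s := sep (I.raw.inducedGraph X) with hs
    have hcard : S.card + A.card + B.card = (X.toSet n).card := by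
      rw [← Finset.card_union_of_disjoint hSA, ← Finset.card_union_of_disjoint
        (Finset.disjoint_union_left.2 ⟨hSB, hAB⟩), hun]
    have hx : 1 ≤ (X.toSet n).card := by
      have := hS.card_pos
      omega
    have hstep (x : List Mask × Mask) (hx : x.1.getD 0 [] = X) (hx' : isCons x.1 = true) :
        RawInstance.workStep n₀ sep I.raw x =
          cond (I.raw.greedyCheap X s.1) (I.raw.leaf x) (I.raw.split x s) := by
      have : natLt (I.raw.members X).length n₀ = false := by
        rw [← Bool.not_eq_true, natLt_iff, I.length_members]
        omega
      unfold RawInstance.workStep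
      rw [hx', hx, this, ← hs]
      rfl
    have hcheap : I.raw.greedyCheap X s.1 = true ↔
        ((I.raw.greedy X).toSet n ∩ X.toSet n).card ≤ S.card := by
      unfold RawInstance.greedyCheap
      rw [Bool.not_eq_true', ← Bool.not_eq_true, natLt_iff, I.length_members, toSet_inter, hsl,
        not_lt, Finset.inter_comm]
    have hsq : √(β₀ * ((X.toSet n).card : ℝ) ^ β) ^ 2 = β₀ * ((X.toSet n).card : ℝ) ^ β :=
      Real.sq_sqrt (by positivity)
    by_cases hc : ((I.raw.greedy X).toSet n ∩ X.toSet n).card ≤ S.card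
    · refine hleaf (fun x hx hx' => ?_) fun hn O hO => ?_
      · rw [hstep x hx hx', hcheap.2 hc, cond_true]
      · refine (hO.card_greedy_le_of_separator hI hn (Nat.cast_nonneg _) le_rfl
          (t := √(β₀ * ((X.toSet n).card : ℝ) ^ β)) ?_ (Real.sqrt_nonneg _)).trans ?_
        · rw [hsq]
          exact ((Nat.cast_le (α := ℝ)).2 hc).trans hSc
        · gcongr
          exact hΦ₁ _ hx
    · have hc' : I.raw.greedyCheap X s.1 = false := by
        rw [← Bool.not_eq_true, hcheap]
        exact hc
      rw [not_le] at hc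
      have hS0 := hS.card_pos
      have hA0 := hA.card_pos
      have hB0 := hB.card_pos
      obtain ⟨RA, hRA, kA, hkA, hiA⟩ := ih A.card (by omega) (I.raw.lift X s.2.1) (by rw [hlA])
      obtain ⟨RB, hRB, kB, hkB, hiB⟩ := ih B.card (by omega) (I.raw.lift X s.2.2) (by rw [hlB])
      rw [hlA] at hRA
      rw [hlB] at hRB
      have hAX : A ⊆ X.toSet n := by
        rw [← hun]
        exact Finset.subset_union_right.trans Finset.subset_union_left
      have hBX : B ⊆ X.toSet n := by
        rw [← hun]
        exact Finset.subset_union_right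
      -- Since `S` is non-empty, |A| + |B| ≤ |X| - 1, and so (2|A| + 1) + (2|B| + 1) + 1 ≤ 2|X| + 1.
      refine ⟨RA ∩ RB, ⟨?_, ?_, ?_, ?_⟩, kB + kA + 1, by omega, fun l M => ?_⟩
      · exact Finset.subset_inter
          ((Finset.compl_subset_compl.2 hAX).trans hRA.compl_subset)
          ((Finset.compl_subset_compl.2 hBX).trans hRB.compl_subset)
      · exact hRA.isSolution.inter hI hAB hadj hRA.compl_subset hRB.compl_subset hRB.isSolution
      -- If a solution avoids `X`, the greedy solution costs nothing in `X` and no split takes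
      -- place.
      · intro O hO h
        rw [hgreedy O hO h] at hc
        simp at hc
      · intro hn O hO
        have h1 : (RA ∩ RB ∩ X.toSet n).card ≤ S.card + (RA ∩ A).card + (RB ∩ B).card := by
          refine (Finset.card_le_card (t := S ∪ RA ∩ A ∪ RB ∩ B) fun v hv => ?_).trans
            ((Finset.card_union_le _ _).trans
              (Nat.add_le_add_right (Finset.card_union_le _ _) _))
          simp only [Finset.mem_inter, ← hun, Finset.mem_union] at hv ⊢
          tauto
        have h2 : (O ∩ A).card + (O ∩ B).card ≤ (O ∩ X.toSet n).card := by
          rw [← Finset.card_union_of_disjoint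
            (hAB.mono Finset.inter_subset_right Finset.inter_subset_right)]
          exact Finset.card_le_card (Finset.union_subset
            (Finset.inter_subset_inter_left hAX) (Finset.inter_subset_inter_left hBX))
        -- A split occurs only if the greedy solution costs more than `S`, so |S| is at most both
        -- bounds.
        have h3 := hO.card_greedy_le_of_separator hI hn (a := S.card) (Nat.cast_nonneg _)
          (by exact_mod_cast hc.le) (t := √(β₀ * ((X.toSet n).card : ℝ) ^ β)) (by rwa [hsq])
          (Real.sqrt_nonneg _)
        have h4 := hRA.card_le hn O hO
        have h5 := hRB.card_le hn O hO
        have h6 := hΦ₂ _ _ hA0 hAc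
        have h7 := hΦ₂ _ _ hB0 hBc
        have h8 := hΦ₁ _ hx
        have h1' : ((RA ∩ RB ∩ X.toSet n).card : ℝ) ≤
          S.card + (RA ∩ A).card + (RB ∩ B).card := by exact_mod_cast h1
        have h2' : ((O ∩ A).card : ℝ) + (O ∩ B).card ≤ (O ∩ X.toSet n).card := by
          exact_mod_cast h2
        set σ := √8 * √(β₀ * ((X.toSet n).card : ℝ) ^ β)
        set L := √(Real.log n)
        have hL : 0 ≤ L := Real.sqrt_nonneg _
        set oA : ℝ := ((O ∩ A).card : ℝ)
        set oB : ℝ := ((O ∩ B).card : ℝ)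
        have hoA : 0 ≤ oA := Nat.cast_nonneg _
        have hoB : 0 ≤ oB := Nat.cast_nonneg _
        -- The recurrence leaves the ratio L(Φ|X| - σ) to both parts; with oA + oB ≤ |O ∩ X| their
        -- sum leaves room for the cost Lσ|O ∩ X| of the separator.
        have h9 : L * Φ A.card * oA ≤ L * (Φ (X.toSet n).card - σ) * oA := by
          gcongr
          linarith
        have h10 : L * Φ B.card * oB ≤ L * (Φ (X.toSet n).card - σ) * oB := by
          gcongr
          linarith
        have h11 : L * (Φ (X.toSet n).card - σ) * (oA + oB) ≤
            L * (Φ (X.toSet n).card - σ) * (O ∩ X.toSet n).card :=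
          mul_le_mul_of_nonneg_left h2' (mul_nonneg hL (by linarith))
        linarith
      · obtain ⟨M₁, h1, h2⟩ := hiA (I.raw.lift X s.2.2 :: l) M
        obtain ⟨M₂, h3, h4⟩ := hiB l M₁
        refine ⟨M₂, by rw [h3, h1, Finset.inter_assoc], ?_⟩
        rw [Function.iterate_succ_apply, hstep _ rfl rfl, hc', cond_false]
        show _^[kB + kA] (I.raw.lift X s.2.1 :: I.raw.lift X s.2.2 :: l, M) = _
        rw [Function.iterate_add_apply, h2, h4]

theorem toSet_costly : (I.raw.costly).toSet n = Finset.univ.filter fun v => 0 < I.cost v := by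
  ext v
  rw [Mask.mem_toSet, RawInstance.costly, verts_raw, getD_map_range, natLt_iff]
  have : I.raw.2.1.getD v 0 = I.cost v := getD_ofFn _ _ _
  rw [this]
  simp

theorem costOf_eq (M : Finset (Fin n)) : I.costOf M = (M ∩ (I.raw.costly).toSet n).card := by
  rw [toSet_costly, Finset.inter_filter, Finset.inter_univ, Finset.card_filter, costOf]
  refine Finset.sum_congr rfl fun v _ => ?_
  have := I.cost_le_one v
  split_ifs <;> omega

end Instance

/-- Reduces both cases of the theorem to solving the recurrence for `Φ`, which may depend on the
constants `n₀` and `β₀` of the class. -/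
theorem HasEfficientSeparators.hasPolyTimeApprox {𝒢 : GraphClass} {α β : ℝ}
    (h𝒢 : HasEfficientSeparators 𝒢 α β) {f : ℕ → ℝ}
    (hf : ∀ (n₀ : ℕ) (β₀ : ℝ), 1 ≤ β₀ → ∃ (Φ : ℕ → ℝ) (K : ℝ),
      (∀ x : ℕ, 1 ≤ x → (n₀ : ℝ) ≤ √(Real.log 2) * Φ x) ∧
      (∀ x : ℕ, 1 ≤ x → √8 * √(β₀ * (x : ℝ) ^ β) ≤ Φ x) ∧
      (∀ x a : ℕ, 1 ≤ a → (a : ℝ) ≤ (1 - α) * x → √8 * √(β₀ * (x : ℝ) ^ β) + Φ a ≤ Φ x) ∧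
      ∀ c : ℕ, 2 ≤ c → Φ c ≤ K * f c) :
    ∃ K : ℝ, HasPolyTimeApprox 𝒢 fun c n => K * (f c * √(Real.log n)) := by
  obtain ⟨n₀, β₀, sep, hβ₀, hpoly, hsep⟩ := h𝒢.exists_function
  obtain ⟨Φ, K, hΦ₀, hΦ₁, hΦ₂, hΦK⟩ := hf n₀ β₀ hβ₀
  refine ⟨K, ?_⟩
  obtain ⟨P, p, hP⟩ := RawInstance.polyTimeOn_solve (n₀ := n₀) (sep := sep)
    (s := {J | ∃ (n : ℕ) (I : Instance n), I.raw = J ∧ 𝒢 n I.graph}) (hpoly.mono <| by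
      rintro g ⟨J, ⟨n, I, rfl, hI⟩, X, rfl, hX⟩
      exact ⟨_, _, hX, h𝒢.1 _ _ _ _ hI
        ⟨SimpleGraph.Embedding.comap ⟨_, I.inclusion_injective X⟩ I.graph⟩,
        (I.inducedGraph_raw X).symm⟩)
  refine ⟨P, p, fun n I hG hI hsol => ?_⟩
  obtain ⟨t, ht, ht', -⟩ := hP I.raw ⟨n, I, rfl, hG⟩
  set R₀ := RawInstance.solve n₀ sep I.raw with hR₀
  have hlen : R₀.length = n := by rw [hR₀, RawInstance.length_solve, I.verts_raw, List.length_range]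
  refine ⟨R₀.toSet n, ⟨t, ?_, ?_⟩, ?_⟩
  · rwa [← enc_maskOf, Mask.maskOf_toSet hlen, ← I.enc_raw]
  · rwa [← I.enc_raw]
  set D := (I.raw.costly).toSet n with hD
  obtain ⟨R, hR, k, hk, hrun⟩ := Instance.exists_isGood h𝒢.1 hG hI hsol hβ₀ hsep hΦ₀ hΦ₁ hΦ₂
    I.raw.costly
  have hR' : R₀.toSet n = R := by
    obtain ⟨M', h1, h2⟩ := hrun [] (I.raw.verts.map fun _ => true)
    have h3 : R₀ = ((RawInstance.workStep n₀ sep I.raw)^[n + n + 1]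
        ([I.raw.costly], I.raw.verts.map fun _ => true)).2 := by
      rw [hR₀]
      unfold RawInstance.solve
      rw [List.foldl_const, I.verts_raw, List.length_cons, List.length_append, List.length_range]
    have h4 : (I.raw.costly.toSet n).card ≤ n := by
      simpa using Finset.card_le_univ (I.raw.costly.toSet n)
    -- The 2n + 1 steps of `solve` are enough, and the remaining ones act trivially on an empty
    -- stack.
    obtain ⟨d, hd⟩ := Nat.exists_eq_add_of_le (show k ≤ n + n + 1 by omega)
    have h5 : (RawInstance.workStep n₀ sep I.raw)^[d] ([], M') = ([], M') :=
      Function.iterate_fixed rfl d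
    rw [h3, hd, add_comm k d, Function.iterate_add_apply, h2, h5]
    dsimp only
    rw [h1, I.verts_raw]
    refine Finset.inter_eq_right.2 fun v _ => ?_
    rw [Mask.mem_toSet, getD_map_range]
  rw [hR']
  refine ⟨hR.isSolution, fun M' hM' => ⟨fun hc => ?_, fun hc => ?_⟩⟩
  · dsimp only
    rw [I.costOf_eq, Finset.univ_inter] at hc
    rw [I.costOf_eq, I.costOf_eq, I.costOf_eq, Finset.univ_inter]
    have hn : 2 ≤ n := hc.trans (by simpa using Finset.card_le_univ D)
    refine (hR.card_le hn M' hM').trans (mul_le_mul_of_nonneg_right ?_ (Nat.cast_nonneg _))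
    have := mul_le_mul_of_nonneg_left (hΦK _ hc) (Real.sqrt_nonneg (Real.log n))
    linarith
  · rw [I.costOf_eq, Finset.univ_inter] at hc
    rw [I.costOf_eq, I.costOf_eq]
    -- If `M'` is free then so is `R`; otherwise `M'` costs at least 1 ≥ c(V).
    rcases (M' ∩ D).eq_empty_or_nonempty with h | h
    · rw [hR.eq_empty M' hM' h]
      simp
    · exact ((Finset.card_le_card Finset.inter_subset_right).trans hc).trans h.card_pos

end GMEG

/-! ### Solving the recurrence for the approximation ratio. -/

theorem mainTheorem4 (𝒢 : GMEG.GraphClass) (α β : ℝ) (hα : 0 < α) (hα' : α < 1 / 2)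
    (hβ : 0 ≤ β) (h𝒢 : GMEG.HasEfficientSeparators 𝒢 α β) :
    (0 < β → ∃ K : ℝ, GMEG.HasPolyTimeApprox 𝒢
      fun c n => K * ((c : ℝ) ^ (β / 2) * Real.sqrt (Real.log (n : ℝ)))) ∧
    (β = 0 → ∃ K : ℝ, GMEG.HasPolyTimeApprox 𝒢
      fun c n => K * (Real.log (c : ℝ) * Real.sqrt (Real.log (n : ℝ)))) := by
  have hlog2 : 0 < √(Real.log 2) := Real.sqrt_pos.2 (Real.log_pos (by norm_num))
  have hα1 : 0 < 1 - α := by linarith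
  constructor
  · intro hβ
    refine h𝒢.hasPolyTimeApprox fun n₀ β₀ hβ₀ => ?_
    set q := (1 - α) ^ (β / 2) with hq
    have hq0 : 0 < q := Real.rpow_pos_of_pos hα1 _
    have hq1 : q < 1 := Real.rpow_lt_one hα1.le (by linarith) (by linarith)
    set σ := √8 * √β₀ with hσ
    have hσ0 : 0 ≤ σ := by positivity
    -- Passing to a part multiplies x^(β/2) by at most q, so C x^(β/2) solves the recurrence once
    -- C(1 - q) ≥ σ, the sum of a geometric series. The second summand pays for sets below `n₀`.
    set C := σ / (1 - q) + n₀ / √(Real.log 2) with hC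
    have h1q : 0 < 1 - q := by linarith
    have hC1 : σ / (1 - q) ≤ C := le_add_of_nonneg_right (by positivity)
    have hC2 : n₀ / √(Real.log 2) ≤ C := le_add_of_nonneg_left (by positivity)
    have hC0 : 0 ≤ C := by positivity
    have hσC : σ ≤ C * (1 - q) := (div_le_iff₀ h1q).1 hC1
    have hsqrt (x : ℕ) : √8 * √(β₀ * (x : ℝ) ^ β) = σ * (x : ℝ) ^ (β / 2) := by
      rw [Real.sqrt_mul (by linarith), Real.sqrt_eq_rpow ((x : ℝ) ^ β),
        ← Real.rpow_mul (Nat.cast_nonneg x), hσ, mul_one_div, mul_assoc]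
    refine ⟨fun x => C * (x : ℝ) ^ (β / 2), C, fun x hx => ?_, fun x hx => ?_,
      fun x a ha hax => ?_, fun c _ => le_rfl⟩
    · have h1 : (1 : ℝ) ≤ (x : ℝ) ^ (β / 2) :=
        Real.one_le_rpow (by exact_mod_cast hx) (by linarith)
      rw [div_le_iff₀ hlog2] at hC2
      nlinarith [mul_nonneg hC0 hlog2.le]
    · rw [hsqrt]
      refine mul_le_mul_of_nonneg_right ?_ (by positivity)
      nlinarith
    · rw [hsqrt]
      have h1 : (a : ℝ) ^ (β / 2) ≤ q * (x : ℝ) ^ (β / 2) := by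
        rw [hq, ← Real.mul_rpow hα1.le (Nat.cast_nonneg x)]
        exact Real.rpow_le_rpow (Nat.cast_nonneg a) hax (by linarith)
      have h2 : (0 : ℝ) ≤ (x : ℝ) ^ (β / 2) := by positivity
      have h3 := mul_le_mul_of_nonneg_left h1 hC0
      have h4 := mul_le_mul_of_nonneg_right hσC h2
      dsimp only
      linarith
  · rintro rfl
    refine h𝒢.hasPolyTimeApprox fun n₀ β₀ hβ₀ => ?_
    set r := -Real.log (1 - α) with hr
    have hr0 : 0 < r := by
      have := Real.log_neg hα1 (by linarith)
      linarith
    set σ := √8 * √β₀ with hσ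
    have hσ0 : 0 ≤ σ := by positivity
    -- Passing to a part lowers log x by at least r, so C(1 + log x) grows by at least Cr ≥ σ per
    -- level. The 1 is needed because log 1 = 0.
    set C := σ + σ / r + n₀ / √(Real.log 2) with hC
    have h1 : 0 ≤ σ / r := by positivity
    have h2 : 0 ≤ n₀ / √(Real.log 2) := by positivity
    have hC0 : 0 ≤ C := by positivity
    have hC1 : σ ≤ C := by linarith
    have hC2 : n₀ / √(Real.log 2) ≤ C := by linarith
    have hC3 : σ ≤ C * r := (div_le_iff₀ hr0).1 (by linarith)
    have hlogx {x : ℕ} : 0 ≤ Real.log x := Real.log_natCast_nonneg x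
    refine ⟨fun x => C * (1 + Real.log x), C / Real.log 2 + C, fun x hx => ?_, fun x hx => ?_,
      fun x a ha hax => ?_, fun c hc => ?_⟩
    · rw [div_le_iff₀ hlog2] at hC2
      have h3 := mul_nonneg (mul_nonneg hC0 hlog2.le) (hlogx (x := x))
      dsimp only
      linarith
    · rw [Real.rpow_zero, mul_one, ← hσ]
      have h3 := mul_nonneg hC0 (hlogx (x := x))
      dsimp only
      linarith
    · rw [Real.rpow_zero, mul_one, ← hσ]
      have ha' : (0 : ℝ) < a := by exact_mod_cast ha
      have hx' : (0 : ℝ) < x := by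
        by_contra! h
        nlinarith
      have h3 := Real.log_le_log ha' hax
      rw [Real.log_mul hα1.ne' hx'.ne'] at h3
      have h4 := mul_le_mul_of_nonneg_left h3 hC0
      dsimp only
      linarith
    · have h3 : 0 < Real.log 2 := Real.log_pos (by norm_num)
      have h4 : Real.log 2 ≤ Real.log c := Real.log_le_log (by norm_num) (by exact_mod_cast hc)
      -- For c ≥ 2 the constant term of C(1 + log c) is absorbed into a multiple of log c.
      have h5 : C ≤ C / Real.log 2 * Real.log c := by
        rw [div_mul_eq_mul_div, le_div_iff₀ h3]
        exact mul_le_mul_of_nonneg_left h4 hC0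
      dsimp only
      linarith
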